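/- Let $\mathbb T$ be the set of isomorphism classes of finite rooted trees (finite connected acyclic undirected graphs with a distinguished vertex, the root). For a rooted tree $t$ write $V(t)$, $E(t)$ for its sets of vertices and edges and $|t|=|V(t)|$. For $e\in E(t)$, removing $e$ splits $t$ into two trees: $R_e(t)$, the one containing the root of $t$, and $P_e(t)$, the other one, rooted at its vertex closest to the root of $t$. For rooted trees $s,t$ and $v\in V(s)$ let $s\cup_v t$ be the rooted tree obtained by joining the root of $t$ to $v$ by a new edge and keeping the root of $s$. For $t_1,t_2,t_3\in\mathbb T$ put $$\alpha(t_1,t_2,t_3)=|\{e\in E(t_2) : R_e(t_2)=t_3,\ P_e(t_2)=t_1\}|,\qquad \beta(t_1,t_2,t_3)=|\{v\in V(t_3) : t_1=t_3\cup_v t_2\}|.$$ The insertion-elimination algebra $\mathfrak g$ is the complex Lie algebra with basis $\{d\}\cup\{D_t^+,D_t^- : t\in\mathbb T\}$ and brackets \begin{align*} [d,D_t^{\pm}]&=\pm|t|\,D_t^{\pm},\qquad [D_t^-,D_t^+]=d,\\ [D_s^+,D_t^+]&=\sum_{r\in\mathbb T}\bigl(\beta(r,s,t)-\beta(r,t,s)\bigr)D_r^+,\\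 [D_s^-,D_t^-]&=\sum_{r\in\mathbb T}\bigl(\alpha(t,r,s)-\alpha(s,r,t)\bigr)D_r^-,\\ [D_s^-,D_t^+]&=\sum_{r\in\mathbb T}\alpha(s,t,r)D_r^++\sum_{r\in\mathbb T}\beta(s,t,r)D_r^-\qquad(s\neq t). \end{align*} Let $\mathfrak g^+$ and $\mathfrak g^-$ be the subalgebras spanned by $\{D_t^+ : t\in\mathbb T\}$ and $\{D_t^- : t\in\mathbb T\}$ respectively. A Lie algebra $\mathfrak L$ over a field $\mathbb F$ is called completely self-centralizing if $\dim\mathfrak L>1$ and, for every nonzero $x\in\mathfrak L$ and every $y\in\mathfrak L$, $[x,y]=0$ implies $y\in\mathbb F x$. Proposition. The subalgebras $\mathfrak g^+$ and $\mathfrak g^-$ of the insertion-elimination algebra $\mathfrak g$ are completely self-centralizing. (In particular, any two linearly independent elements of $\mathfrak g^+$, or of $\mathfrak g^-$, have nonzero bracket.) -/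

import Mathlib

namespace InsElim

/-- A finite rooted tree: a finite set of vertices with a distinguished root, each vertex `x ≠ root`
being joined by an edge to `parent x`, such that every vertex is connected to the root.
These are the same as finite connected acyclic graphs with a distinguished vertex, with the same
isomorphisms: see `graph_isTree`, `exists_graph_eq` and `iso_iff_graph` below. -/
structure RTree where
  V : Type
  finite : Finite V
  root : V
  parent : V → V
  parent_root : parent root = root
  exists_iterate : ∀ x, ∃ k : ℕ, parent^[k] x = root

namespace RTree

instance (t : RTree) : Finite t.V := t.finite

theorem iterate_root (t : RTree) (k : ℕ) : t.parent^[k] t.root = t.root :=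
  Function.iterate_fixed t.parent_root k

theorem ind (t : RTree) {p : t.V → Prop} (h0 : p t.root)
    (h1 : ∀ x, x ≠ t.root → p (t.parent x) → p x) (x : t.V) : p x := by
  obtain ⟨k, hk⟩ := t.exists_iterate x
  induction k generalizing x with
  | zero => simp only [Function.iterate_zero, id] at hk; exact hk ▸ h0
  | succ k ih =>
    by_cases hx : x = t.root
    · exact hx ▸ h0
    · exact h1 x hx (ih _ (by simpa using hk))

/-- Isomorphism of rooted trees. -/
def Iso (s t : RTree) : Prop :=
  ∃ φ : s.V ≃ t.V, φ s.root = t.root ∧ ∀ x, φ (s.parent x) = t.parent (φ x)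

theorem Iso.refl (s : RTree) : Iso s s := ⟨Equiv.refl _, rfl, fun _ => rfl⟩

theorem Iso.symm {s t : RTree} : Iso s t → Iso t s := by
  rintro ⟨φ, h0, h1⟩
  refine ⟨φ.symm, by rw [← h0]; simp, fun x => ?_⟩
  apply φ.injective
  simp [h1]

theorem Iso.trans {s t u : RTree} : Iso s t → Iso t u → Iso s u := by
  rintro ⟨φ, h0, h1⟩ ⟨ψ, k0, k1⟩
  exact ⟨φ.trans ψ, by simp [h0, k0], fun x => by simp [h1, k1]⟩

instance setoid : Setoid RTree := ⟨Iso, Iso.refl, Iso.symm, Iso.trans⟩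

/-- The edges of `t`, each represented by its endpoint `w ≠ root` farther from the root:
`w` stands for the edge joining `w` and `parent w`. -/
abbrev E (t : RTree) : Type := {w : t.V // w ≠ t.root}

instance (t : RTree) : Finite t.E := inferInstanceAs (Finite {w : t.V // w ≠ t.root})

/-- `t.Below w x`: the path from `x` to the root passes through `w`. -/
def Below (t : RTree) (w x : t.V) : Prop := ∃ k : ℕ, t.parent^[k] x = w

theorem below_refl (t : RTree) (w : t.V) : t.Below w w := ⟨0, rfl⟩

theorem below_iff (t : RTree) (w x : t.V) : t.Below w x ↔ x = w ∨ t.Below w (t.parent x) := by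
  constructor
  · rintro ⟨k, hk⟩
    cases k with
    | zero => exact Or.inl hk
    | succ k => exact Or.inr ⟨k, by simpa using hk⟩
  · rintro (h | ⟨k, hk⟩)
    · exact ⟨0, h⟩
    · exact ⟨k + 1, by simpa using hk⟩

theorem below_root_iff (t : RTree) (w : t.V) : t.Below w t.root ↔ w = t.root := by
  constructor
  · rintro ⟨k, hk⟩
    rw [iterate_root] at hk
    exact hk.symm
  · rintro rfl
    exact t.below_refl _

theorem root_below (t : RTree) (x : t.V) : t.Below t.root x := t.exists_iterate x

theorem below_trans (t : RTree) {a b c : t.V} : t.Below a b → t.Below b c → t.Below a c := by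
  rintro ⟨k, rfl⟩ ⟨l, rfl⟩
  exact ⟨k + l, by rw [Function.iterate_add_apply]⟩

theorem below_antisymm (t : RTree) {a b : t.V} (h : t.Below a b) (h' : t.Below b a) : a = b := by
  obtain ⟨k, hk⟩ := h
  obtain ⟨l, hl⟩ := h'
  by_cases hz : k + l = 0
  · have : k = 0 := by omega
    subst this
    exact hk.symm
  have hp : t.parent^[k + l] a = a := by rw [Function.iterate_add_apply, hl, hk]
  obtain ⟨m, hm⟩ := t.exists_iterate a
  have ha : a = t.root := by
    have h1 : t.parent^[(k + l) * m] a = a := by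
      rw [Function.iterate_mul]
      exact Function.iterate_fixed hp m
    have h2 : m ≤ (k + l) * m := Nat.le_mul_of_pos_left m (by omega)
    obtain ⟨n, hn⟩ := Nat.exists_eq_add_of_le' h2
    rw [hn, Function.iterate_add_apply, hm, iterate_root] at h1
    exact h1.symm
  rw [ha, iterate_root] at hl
  rw [ha, hl]

theorem below_total (t : RTree) {a b x : t.V} (h : t.Below a x) (h' : t.Below b x) :
    t.Below a b ∨ t.Below b a := by
  obtain ⟨k, rfl⟩ := h
  obtain ⟨l, rfl⟩ := h'
  rcases le_total k l with hkl | hkl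
  · obtain ⟨n, rfl⟩ := Nat.exists_eq_add_of_le' hkl
    exact Or.inr ⟨n, by rw [Function.iterate_add_apply]⟩
  · obtain ⟨n, rfl⟩ := Nat.exists_eq_add_of_le' hkl
    exact Or.inl ⟨n, by rw [Function.iterate_add_apply]⟩

/-! ### Comparison with graphs

Finite rooted trees in the sense of `RTree` are the same as finite connected acyclic graphs with a
distinguished vertex, with the same isomorphisms. -/

/-- The underlying undirected graph. -/
def graph (t : RTree) : SimpleGraph t.V := SimpleGraph.fromRel fun x y => t.parent x = y

theorem graph_adj_iff (t : RTree) (x y : t.V) :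
    t.graph.Adj x y ↔ x ≠ y ∧ (t.parent x = y ∨ t.parent y = x) :=
  SimpleGraph.fromRel_adj _ _ _

theorem parent_ne (t : RTree) {x : t.V} (hx : x ≠ t.root) : t.parent x ≠ x := by
  intro h
  obtain ⟨k, hk⟩ := t.exists_iterate x
  rw [Function.iterate_fixed h] at hk
  exact hx hk

theorem graph_adj_parent (t : RTree) {x : t.V} (hx : x ≠ t.root) : t.graph.Adj x (t.parent x) := by
  simp [graph, (t.parent_ne hx).symm]

theorem graph_connected (t : RTree) : t.graph.Connected := by
  have h : ∀ x, t.graph.Reachable x t.root := by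
    intro x
    induction x using t.ind with
    | h0 => exact SimpleGraph.Reachable.refl _
    | h1 x hx ih => exact (t.graph_adj_parent hx).reachable.trans ih
  have : Nonempty t.V := ⟨t.root⟩
  exact ⟨fun x y => (h x).trans (h y).symm⟩

theorem graph_isTree (t : RTree) : t.graph.IsTree := by
  rw [SimpleGraph.isTree_iff_connected_and_card]
  refine ⟨t.graph_connected, le_antisymm ?_ t.graph_connected.card_vert_le_card_edgeSet_add_one⟩
  let f : t.E → t.graph.edgeSet := fun e => ⟨s(e.1, t.parent e.1), t.graph_adj_parent e.2⟩
  have hf : Function.Surjective f := by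
    rintro ⟨e, he⟩
    induction e using Sym2.ind with
    | _ x y =>
      obtain ⟨hne, h | h⟩ := (t.graph_adj_iff x y).1 he
      · have hx : x ≠ t.root := by
          rintro rfl
          rw [t.parent_root] at h
          exact hne h
        exact ⟨⟨x, hx⟩, Subtype.ext (by simp [f, h])⟩
      · have hy : y ≠ t.root := by
          rintro rfl
          rw [t.parent_root] at h
          exact hne h.symm
        exact ⟨⟨y, hy⟩, Subtype.ext (by simp [f, h])⟩
  have h1 := Nat.card_le_card_of_surjective f hf
  have h2 : Nat.card t.E < Nat.card t.V := Finite.card_subtype_lt (x := t.root) (by simp)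
  omega

theorem iso_iff_graph (s t : RTree) :
    Iso s t ↔ ∃ φ : s.graph ≃g t.graph, φ s.root = t.root := by
  constructor
  · rintro ⟨φ, h0, h1⟩
    exact ⟨⟨φ, by simp [graph, ← h1]⟩, h0⟩
  · rintro ⟨φ, h0⟩
    refine ⟨φ.toEquiv, h0, fun x => ?_⟩
    change φ (s.parent x) = t.parent (φ x)
    induction x using s.ind with
    | h0 => rw [s.parent_root, h0, t.parent_root]
    | h1 x hx ih =>
      obtain ⟨-, h | h⟩ :=
        (t.graph_adj_iff _ _).1 (φ.map_adj_iff.2 (s.graph_adj_parent hx))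
      · exact h.symm
      · rw [← ih] at h
        exact absurd (s.below_antisymm ⟨1, φ.injective h⟩ ⟨1, rfl⟩) (s.parent_ne hx).symm

theorem exists_graph_eq {V : Type} [Finite V] (G : SimpleGraph V) (hG : G.IsTree) (r : V) :
    ∃ t : RTree, ∃ φ : t.graph ≃g G, φ t.root = r := by
  classical
  have h1 : ∀ x, ∃ y, x ≠ r → G.Adj x y ∧ G.dist y r + 1 = G.dist x r := by
    intro x
    by_cases hx : x = r
    · exact ⟨x, fun h => absurd hx h⟩
    · obtain ⟨p, hp⟩ := hG.connected.exists_walk_length_eq_dist x r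
      cases p with
      | nil => exact absurd rfl hx
      | @cons _ y _ h q =>
        refine ⟨y, fun _ => ⟨h, le_antisymm ?_ ?_⟩⟩
        · rw [← hp, SimpleGraph.Walk.length_cons]
          exact Nat.succ_le_succ (SimpleGraph.dist_le q)
        · have := hG.connected.dist_triangle (u := x) (v := y) (w := r)
          rw [SimpleGraph.dist_eq_one_iff_adj.2 h] at this
          omega
  choose f hf using h1
  let p : V → V := fun x => if x = r then r else f x
  have hp : ∀ n x, G.dist x r = n → ∃ k : ℕ, p^[k] x = r := by
    intro n
    induction n with
    | zero => exact fun x hx => ⟨0, (hG.connected.dist_eq_zero_iff).1 hx⟩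
    | succ n ih =>
      intro x hx
      have hxr : x ≠ r := by
        rintro rfl
        simp at hx
      obtain ⟨k, hk⟩ := ih (f x) (by have := (hf x hxr).2; omega)
      exact ⟨k + 1, by simpa [p, hxr] using hk⟩
  let t : RTree := ⟨V, inferInstance, r, p, by simp [p], fun x => hp _ x rfl⟩
  have hle : t.graph ≤ G := by
    have h2 : ∀ x y, x ≠ y → p x = y → G.Adj x y := by
      rintro x y hne rfl
      by_cases hx : x = r
      · simp [p, hx] at hne
      · simpa [p, hx] using (hf x hx).1
    intro x y hxy
    obtain ⟨hne, h | h⟩ := (t.graph_adj_iff x y).1 hxy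
    · exact h2 x y hne h
    · exact (h2 y x hne.symm h).symm
  have heq : t.graph = G := by
    have hsub := SimpleGraph.edgeSet_mono hle
    have c1 := ((SimpleGraph.isTree_iff_connected_and_card).1 t.graph_isTree).2
    have c2 := ((SimpleGraph.isTree_iff_connected_and_card).1 hG).2
    have c3 : Nat.card G.edgeSet = Nat.card t.graph.edgeSet :=
      Nat.succ_injective (c2.trans c1.symm)
    exact SimpleGraph.edgeSet_injective
      (Set.eq_of_subset_of_ncard_le hsub (le_of_eq c3) (Set.toFinite _))
  exact ⟨t, ⟨Equiv.refl V, by rw [← heq]; rfl⟩, rfl⟩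

open Classical in
/-- The tree `s ∪_v t`: the root of `t` is joined to the vertex `v` of `s` by a new edge,
and the root is that of `s`. -/
noncomputable abbrev graft (s : RTree) (v : s.V) (t : RTree) : RTree where
  V := s.V ⊕ t.V
  finite := inferInstance
  root := Sum.inl s.root
  parent := Sum.elim (fun x => Sum.inl (s.parent x))
    (fun y => if y = t.root then Sum.inl v else Sum.inr (t.parent y))
  parent_root := by simp [s.parent_root]
  exists_iterate := by
    have hl : ∀ x : s.V, ∃ k : ℕ, (Sum.elim (fun x => Sum.inl (s.parent x))
        (fun y => if y = t.root then Sum.inl v else Sum.inr (t.parent y)))^[k]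
          (Sum.inl x : s.V ⊕ t.V) = Sum.inl s.root := by
      intro x
      induction x using s.ind with
      | h0 => exact ⟨0, rfl⟩
      | h1 x _ ih =>
        obtain ⟨k, hk⟩ := ih
        exact ⟨k + 1, by simpa using hk⟩
    rintro (x | y)
    · exact hl x
    · induction y using t.ind with
      | h0 =>
        obtain ⟨k, hk⟩ := hl v
        exact ⟨k + 1, by simpa using hk⟩
      | h1 y hy ih =>
        obtain ⟨k, hk⟩ := ih
        exact ⟨k + 1, by simpa [hy] using hk⟩

/-- `R_e(t)`: the component containing the root of `t` after the edge `e` is removed. -/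
abbrev R (t : RTree) (e : t.E) : RTree where
  V := {x : t.V // ¬ t.Below e.1 x}
  finite := inferInstance
  root := ⟨t.root, fun h => e.2 ((t.below_root_iff _).1 h)⟩
  parent x := ⟨t.parent x.1, fun h => x.2 ((t.below_iff _ _).2 (Or.inr h))⟩
  parent_root := Subtype.ext t.parent_root
  exists_iterate := by
    rintro ⟨x, hx⟩
    revert hx
    refine t.ind (p := fun x => ∀ hx, ∃ k : ℕ, _^[k] (⟨x, hx⟩ : {x : t.V // ¬ t.Below e.1 x}) = _)
      (fun _ => ⟨0, rfl⟩) (fun x _ ih hx => ?_) x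
    obtain ⟨k, hk⟩ := ih (fun h => hx ((t.below_iff _ _).2 (Or.inr h)))
    exact ⟨k + 1, by simpa using hk⟩

open Classical in
/-- `P_e(t)`: the component not containing the root of `t` after the edge `e` is removed,
rooted at its vertex closest to the root of `t`, which is the endpoint of `e` lying in it. -/
noncomputable abbrev P (t : RTree) (e : t.E) : RTree where
  V := {x : t.V // t.Below e.1 x}
  finite := inferInstance
  root := ⟨e.1, t.below_refl _⟩
  parent x := if h : x.1 = e.1 then x
    else ⟨t.parent x.1, ((t.below_iff _ _).1 x.2).resolve_left h⟩
  parent_root := by simp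
  exists_iterate := by
    rintro ⟨x, hx⟩
    have hx' := hx
    obtain ⟨k, hk⟩ := hx'
    induction k generalizing x with
    | zero => exact ⟨0, Subtype.ext hk⟩
    | succ k ih =>
      by_cases hxe : x = e.1
      · exact ⟨0, Subtype.ext hxe⟩
      · obtain ⟨l, hl⟩ := ih (t.parent x) (((t.below_iff _ _).1 hx).resolve_left hxe)
          (by simpa using hk)
        exact ⟨l + 1, by simpa [hxe] using hl⟩

/-- `|t|`, the number of vertices. -/
noncomputable def size (t : RTree) : ℕ := Nat.card t.V

/-! ### Isomorphisms between the constructions -/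

theorem iso_of_embed {s t : RTree} {X : Type} (i : s.V → X) (j : t.V → X)
    (hi : Function.Injective i) (hj : Function.Injective j)
    (h1 : ∀ x, ∃ y, i x = j y) (h2 : ∀ y, ∃ x, i x = j y)
    (h0 : i s.root = j t.root)
    (hp : ∀ x y, i x = j y → i (s.parent x) = j (t.parent y)) : s ≈ t := by
  choose f hf using h1
  have hb : Function.Bijective f := by
    refine ⟨fun a b hab => hi (by rw [hf, hf, hab]), fun y => ?_⟩
    obtain ⟨x, hx⟩ := h2 y
    exact ⟨x, hj (by rw [← hf, hx])⟩
  exact ⟨Equiv.ofBijective f hb, hj (by simp [← hf, h0]),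
    fun x => hj (by simpa [← hf] using hp x (f x) (hf x))⟩

theorem iso_of_map {s t : RTree} (f : s.V → t.V) (hf : Function.Bijective f)
    (h0 : f s.root = t.root) (hp : ∀ x, f (s.parent x) = t.parent (f x)) : s ≈ t :=
  ⟨Equiv.ofBijective f hf, h0, hp⟩

theorem graft_congr {s s' t t' : RTree} (φ : s.V ≃ s'.V) (h0 : φ s.root = s'.root)
    (h1 : ∀ x, φ (s.parent x) = s'.parent (φ x)) (ht : t ≈ t') (v : s.V) :
    s.graft v t ≈ s'.graft (φ v) t' := by
  obtain ⟨ψ, k0, k1⟩ := ht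
  refine ⟨Equiv.sumCongr φ ψ, by simp [graft, h0], ?_⟩
  rintro (x | y)
  · simp [graft, h1]
  · have : ψ y = t'.root ↔ y = t.root := by rw [← k0]; exact ψ.injective.eq_iff
    by_cases hy : y = t.root <;> simp [graft, this, hy, k0, k1]

theorem graft_comm (u : RTree) (v w : u.V) (s t : RTree) :
    (u.graft v t).graft (Sum.inl w) s ≈ (u.graft w s).graft (Sum.inl v) t := by
  refine ⟨⟨Sum.elim (Sum.elim (fun x => Sum.inl (Sum.inl x)) Sum.inr)
      (fun y => Sum.inl (Sum.inr y)), Sum.elim (Sum.elim (fun x => Sum.inl (Sum.inl x)) Sum.inr)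
      (fun y => Sum.inl (Sum.inr y)), ?_, ?_⟩, rfl, ?_⟩
  · rintro ((x | x) | x) <;> rfl
  · rintro ((x | x) | x) <;> rfl
  · rintro ((x | x) | x)
    · rfl
    · by_cases hx : x = t.root <;> simp [graft, hx]
    · by_cases hx : x = s.root <;> simp [graft, hx]

theorem graft_assoc (u : RTree) (v : u.V) (t : RTree) (w : t.V) (s : RTree) :
    (u.graft v t).graft (Sum.inr w) s ≈ u.graft v (t.graft w s) := by
  refine ⟨Equiv.sumAssoc _ _ _, rfl, ?_⟩
  rintro ((x | x) | x)
  · rfl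
  · by_cases hx : x = t.root <;> simp [graft, hx]
  · by_cases hx : x = s.root <;> simp [graft, hx]

/-! Behaviour of `Below` under the constructions. -/

theorem below_graft_inl_inl (u : RTree) (v : u.V) (t : RTree) (a b : u.V) :
    (u.graft v t).Below (Sum.inl a) (Sum.inl b) ↔ u.Below a b := by
  induction b using u.ind with
  | h0 =>
    have h := below_root_iff (u.graft v t) (Sum.inl a)
    exact (h.trans Sum.inl_injective.eq_iff).trans (below_root_iff u a).symm
  | h1 b hb ih =>
    rw [below_iff, below_iff u, ← ih]
    exact or_congr Sum.inl_injective.eq_iff Iff.rfl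

theorem below_graft_inr_inl (u : RTree) (v : u.V) (t : RTree) (a : t.V) (b : u.V) :
    ¬ (u.graft v t).Below (Sum.inr a) (Sum.inl b) := by
  induction b using u.ind with
  | h0 =>
    have h := below_root_iff (u.graft v t) (Sum.inr a)
    exact fun h' => by simpa [graft] using h.1 h'
  | h1 b hb ih =>
    rw [below_iff]
    rintro (h | h)
    · simp at h
    · exact ih h

theorem below_graft_inl_inr (u : RTree) (v : u.V) (t : RTree) (a : u.V) (b : t.V) :
    (u.graft v t).Below (Sum.inl a) (Sum.inr b) ↔ u.Below a v := by
  induction b using t.ind with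
  | h0 =>
    rw [below_iff, ← below_graft_inl_inl u v t]
    simp [graft]
  | h1 b hb ih =>
    rw [below_iff, ← ih]
    simp [graft, hb]

theorem below_graft_inr_inr (u : RTree) (v : u.V) (t : RTree) (a b : t.V) :
    (u.graft v t).Below (Sum.inr a) (Sum.inr b) ↔ t.Below a b := by
  induction b using t.ind with
  | h0 =>
    rw [below_iff, below_root_iff]
    have := below_graft_inr_inl u v t a v
    simp only [graft] at this ⊢
    simp [this, eq_comm]
  | h1 b hb ih =>
    rw [below_iff, below_iff t, ← ih]
    simp [graft, hb]

theorem below_R (t : RTree) (e : t.E) (a b : (t.R e).V) :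
    (t.R e).Below a b ↔ t.Below a.1 b.1 := by
  induction b using (t.R e).ind with
  | h0 =>
    rw [below_root_iff]
    exact Subtype.ext_iff.trans (below_root_iff _ _).symm
  | h1 b hb ih =>
    rw [below_iff, below_iff t, Subtype.ext_iff]
    exact or_congr Iff.rfl ih

theorem P_parent_of_ne (t : RTree) (e : t.E) (b : (t.P e).V) (hb : b.1 ≠ e.1) :
    ((t.P e).parent b).1 = t.parent b.1 := by
  simp [P, hb]

theorem below_P (t : RTree) (e : t.E) (a b : (t.P e).V) :
    (t.P e).Below a b ↔ t.Below a.1 b.1 := by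
  induction b using (t.P e).ind with
  | h0 =>
    rw [below_root_iff]
    constructor
    · rintro rfl
      exact below_refl _ _
    · intro h
      exact Subtype.ext (t.below_antisymm h a.2)
  | h1 b hb ih =>
    have hb' : b.1 ≠ e.1 := fun h => hb (Subtype.ext h)
    rw [below_iff, below_iff t, Subtype.ext_iff, ih, P_parent_of_ne _ _ _ hb']

/-! Transport of cuts along isomorphisms. -/

theorem below_map {s t : RTree} (φ : s.V ≃ t.V) (h0 : φ s.root = t.root)
    (h1 : ∀ x, φ (s.parent x) = t.parent (φ x)) (a b : s.V) :
    t.Below (φ a) (φ b) ↔ s.Below a b := by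
  induction b using s.ind with
  | h0 => rw [h0, below_root_iff, below_root_iff, ← h0, φ.injective.eq_iff]
  | h1 b hb ih => rw [below_iff, below_iff s, ← ih, h1, φ.injective.eq_iff]

theorem R_map {s t : RTree} (φ : s.V ≃ t.V) (h0 : φ s.root = t.root)
    (h1 : ∀ x, φ (s.parent x) = t.parent (φ x)) (e : s.E) (f : t.E) (hef : φ e.1 = f.1) :
    s.R e ≈ t.R f := by
  refine iso_of_embed (X := t.V) (fun x => φ x.1) (fun y => y.1)
    (fun a b h => Subtype.ext (φ.injective h)) Subtype.val_injective ?_ ?_ h0 ?_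
  · intro x
    exact ⟨⟨φ x.1, by rw [← hef, below_map φ h0 h1]; exact x.2⟩, rfl⟩
  · intro y
    exact ⟨⟨φ.symm y.1, by rw [← below_map φ h0 h1, hef]; simpa using y.2⟩, by simp⟩
  · intro x y hxy
    simp only [R, h1]
    rw [← hxy]

theorem P_map {s t : RTree} (φ : s.V ≃ t.V) (h0 : φ s.root = t.root)
    (h1 : ∀ x, φ (s.parent x) = t.parent (φ x)) (e : s.E) (f : t.E) (hef : φ e.1 = f.1) :
    s.P e ≈ t.P f := by
  refine iso_of_embed (X := t.V) (fun x => φ x.1) (fun y => y.1)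
    (fun a b h => Subtype.ext (φ.injective h)) Subtype.val_injective ?_ ?_ hef ?_
  · intro x
    exact ⟨⟨φ x.1, by rw [← hef, below_map φ h0 h1]; exact x.2⟩, rfl⟩
  · intro y
    exact ⟨⟨φ.symm y.1, by rw [← below_map φ h0 h1, hef]; simpa using y.2⟩, by simp⟩
  · intro x y hxy
    by_cases hx : x.1 = e.1
    · have hy : y.1 = f.1 := by rw [← hxy, hx, hef]
      simpa [P, hx, hy] using hef
    · have hy : y.1 ≠ f.1 := by rw [← hxy, ← hef]; exact fun h => hx (φ.injective h)
      rw [P_parent_of_ne _ _ _ hx, P_parent_of_ne _ _ _ hy, h1, hxy]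

/-! Cuts of a grafted tree. -/

/-- The edge of `u ∪_v t` coming from an edge of `u`. -/
abbrev edgeL (u : RTree) (v : u.V) (t : RTree) (e : u.E) : (u.graft v t).E :=
  ⟨Sum.inl e.1, fun h => e.2 (Sum.inl_injective h)⟩

/-- The edge of `u ∪_v t` above a vertex of `t`. -/
abbrev edgeR (u : RTree) (v : u.V) (t : RTree) (y : t.V) : (u.graft v t).E :=
  ⟨Sum.inr y, fun h => Sum.inr_ne_inl h⟩

theorem R_join (u : RTree) (v : u.V) (t : RTree) : (u.graft v t).R (edgeR u v t t.root) ≈ u := by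
  refine iso_of_embed (X := (u.graft v t).V) Subtype.val Sum.inl Subtype.val_injective
    Sum.inl_injective ?_ ?_ rfl ?_
  · rintro ⟨x | y, hx⟩
    · exact ⟨x, rfl⟩
    · exact absurd ((below_graft_inr_inr u v t _ _).2 (t.root_below y)) hx
  · intro y
    exact ⟨⟨Sum.inl y, below_graft_inr_inl u v t _ _⟩, rfl⟩
  · rintro ⟨x, hx⟩ y rfl
    rfl

theorem P_join (u : RTree) (v : u.V) (t : RTree) : (u.graft v t).P (edgeR u v t t.root) ≈ t := by
  refine iso_of_embed (X := (u.graft v t).V) Subtype.val Sum.inr Subtype.val_injective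
    Sum.inr_injective ?_ ?_ rfl ?_
  · rintro ⟨x | y, hx⟩
    · exact absurd hx (below_graft_inr_inl u v t _ _)
    · exact ⟨y, rfl⟩
  · intro y
    exact ⟨⟨Sum.inr y, (below_graft_inr_inr u v t _ _).2 (t.root_below y)⟩, rfl⟩
  · rintro ⟨x, hx⟩ y rfl
    by_cases hy : y = t.root
    · simp [P, edgeR, hy, t.parent_root]
    · simp [P, edgeR, hy, graft]

theorem P_edgeR (u : RTree) (v : u.V) (t : RTree) (e : t.E) :
    (u.graft v t).P (edgeR u v t e.1) ≈ t.P e := by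
  refine iso_of_embed (X := (u.graft v t).V) Subtype.val (fun y => Sum.inr y.1)
    Subtype.val_injective (Sum.inr_injective.comp Subtype.val_injective) ?_ ?_ rfl ?_
  · rintro ⟨x | y, hx⟩
    · exact absurd hx (below_graft_inr_inl u v t _ _)
    · exact ⟨⟨y, (below_graft_inr_inr u v t _ _).1 hx⟩, rfl⟩
  · intro y
    exact ⟨⟨Sum.inr y.1, (below_graft_inr_inr u v t _ _).2 y.2⟩, rfl⟩
  · rintro ⟨x, hx⟩ y rfl
    by_cases hy : y.1 = e.1
    · simp [P, edgeR, hy]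
    · have : y.1 ≠ t.root := by
        intro h
        have := y.2
        rw [h, below_root_iff] at this
        exact e.2 this
      simp [P, edgeR, hy, graft, this]

theorem R_edgeR (u : RTree) (v : u.V) (t : RTree) (e : t.E) :
    (u.graft v t).R (edgeR u v t e.1) ≈ u.graft v (t.R e) := by
  refine iso_of_embed (X := (u.graft v t).V) Subtype.val (Sum.map id Subtype.val)
    Subtype.val_injective (Sum.map_injective.2 ⟨Function.injective_id, Subtype.val_injective⟩)
    ?_ ?_ rfl ?_
  · rintro ⟨x | y, hx⟩
    · exact ⟨Sum.inl x, rfl⟩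
    · exact ⟨Sum.inr ⟨y, fun h => hx ((below_graft_inr_inr u v t _ _).2 h)⟩, rfl⟩
  · rintro (x | y)
    · exact ⟨⟨Sum.inl x, below_graft_inr_inl u v t _ _⟩, rfl⟩
    · exact ⟨⟨Sum.inr y.1, fun h => y.2 ((below_graft_inr_inr u v t _ _).1 h)⟩, rfl⟩
  · rintro ⟨x, hx⟩ (y | y) rfl
    · rfl
    · by_cases hy : y.1 = t.root
      · have : y = (t.R e).root := Subtype.ext hy
        simp [R, graft, this]
      · have : y ≠ (t.R e).root := fun h => hy (congrArg Subtype.val h)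
        simp only [R, graft, Sum.map_inr, Sum.elim_inr, hy, if_false]
        rw [if_neg this]
        rfl

theorem P_edgeL_of_not (u : RTree) (v : u.V) (t : RTree) (e : u.E) (h : ¬ u.Below e.1 v) :
    (u.graft v t).P (edgeL u v t e) ≈ u.P e := by
  refine iso_of_embed (X := (u.graft v t).V) Subtype.val (fun y => Sum.inl y.1)
    Subtype.val_injective (Sum.inl_injective.comp Subtype.val_injective) ?_ ?_ rfl ?_
  · rintro ⟨x | y, hx⟩
    · exact ⟨⟨x, (below_graft_inl_inl u v t _ _).1 hx⟩, rfl⟩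
    · exact absurd ((below_graft_inl_inr u v t _ _).1 hx) h
  · intro y
    exact ⟨⟨Sum.inl y.1, (below_graft_inl_inl u v t _ _).2 y.2⟩, rfl⟩
  · rintro ⟨x, hx⟩ y rfl
    by_cases hy : y.1 = e.1
    · simp [P, edgeL, hy]
    · simp [P, edgeL, hy, graft]

theorem R_edgeL_of_not (u : RTree) (v : u.V) (t : RTree) (e : u.E) (h : ¬ u.Below e.1 v) :
    (u.graft v t).R (edgeL u v t e) ≈ (u.R e).graft ⟨v, h⟩ t := by
  refine iso_of_embed (X := (u.graft v t).V) Subtype.val (Sum.map Subtype.val id)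
    Subtype.val_injective (Sum.map_injective.2 ⟨Subtype.val_injective, Function.injective_id⟩)
    ?_ ?_ rfl ?_
  · rintro ⟨x | y, hx⟩
    · exact ⟨Sum.inl ⟨x, fun h => hx ((below_graft_inl_inl u v t _ _).2 h)⟩, rfl⟩
    · exact ⟨Sum.inr y, rfl⟩
  · rintro (x | y)
    · exact ⟨⟨Sum.inl x.1, fun h => x.2 ((below_graft_inl_inl u v t _ _).1 h)⟩, rfl⟩
    · exact ⟨⟨Sum.inr y, fun h' => h ((below_graft_inl_inr u v t _ _).1 h')⟩, rfl⟩
  · rintro ⟨x, hx⟩ (y | y) rfl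
    · rfl
    · by_cases hy : y = t.root <;> simp [R, graft, hy]

theorem P_edgeL (u : RTree) (v : u.V) (t : RTree) (e : u.E) (h : u.Below e.1 v) :
    (u.graft v t).P (edgeL u v t e) ≈ (u.P e).graft ⟨v, h⟩ t := by
  refine iso_of_embed (X := (u.graft v t).V) Subtype.val (Sum.map Subtype.val id)
    Subtype.val_injective (Sum.map_injective.2 ⟨Subtype.val_injective, Function.injective_id⟩)
    ?_ ?_ rfl ?_
  · rintro ⟨x | y, hx⟩
    · exact ⟨Sum.inl ⟨x, (below_graft_inl_inl u v t _ _).1 hx⟩, rfl⟩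
    · exact ⟨Sum.inr y, rfl⟩
  · rintro (x | y)
    · exact ⟨⟨Sum.inl x.1, (below_graft_inl_inl u v t _ _).2 x.2⟩, rfl⟩
    · exact ⟨⟨Sum.inr y, (below_graft_inl_inr u v t _ _).2 h⟩, rfl⟩
  · rintro ⟨x, hx⟩ (y | y) rfl
    · by_cases hy : y.1 = e.1
      · simp [P, edgeL, graft, hy]
      · simp [P, edgeL, graft, hy]
    · by_cases hy : y = t.root <;> simp [P, edgeL, graft, hy]

theorem R_edgeL (u : RTree) (v : u.V) (t : RTree) (e : u.E) (h : u.Below e.1 v) :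
    (u.graft v t).R (edgeL u v t e) ≈ u.R e := by
  refine iso_of_embed (X := (u.graft v t).V) Subtype.val (fun y => Sum.inl y.1)
    Subtype.val_injective (Sum.inl_injective.comp Subtype.val_injective) ?_ ?_ rfl ?_
  · rintro ⟨x | y, hx⟩
    · exact ⟨⟨x, fun h => hx ((below_graft_inl_inl u v t _ _).2 h)⟩, rfl⟩
    · exact absurd ((below_graft_inl_inr u v t _ _).2 h) hx
  · intro y
    exact ⟨⟨Sum.inl y.1, fun h => y.2 ((below_graft_inl_inl u v t _ _).1 h)⟩, rfl⟩
  · rintro ⟨x, hx⟩ y rfl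
    rfl

/-- Every tree is obtained by grafting the two parts of a cut. -/
theorem exists_graft (t : RTree) (e : t.E) : ∃ v, (t.R e).graft v (t.P e) ≈ t := by
  have hp : ¬ t.Below e.1 (t.parent e.1) := by
    intro h
    have h1 : t.Below (t.parent e.1) e.1 := ⟨1, rfl⟩
    have h2 := t.below_antisymm h h1
    apply e.2
    obtain ⟨k, hk⟩ := t.exists_iterate e.1
    rw [Function.iterate_fixed h2.symm] at hk
    exact hk
  refine ⟨⟨t.parent e.1, hp⟩, ?_⟩
  refine iso_of_map (Sum.elim Subtype.val Subtype.val) ⟨?_, ?_⟩ rfl ?_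
  · rintro (⟨x, hx⟩ | ⟨x, hx⟩) (⟨y, hy⟩ | ⟨y, hy⟩) h
    · exact congrArg Sum.inl (Subtype.ext h)
    · simp only [Sum.elim_inl, Sum.elim_inr] at h
      exact absurd (h ▸ hy) hx
    · simp only [Sum.elim_inl, Sum.elim_inr] at h
      exact absurd (h ▸ hx) hy
    · exact congrArg Sum.inr (Subtype.ext h)
  · intro x
    by_cases hx : t.Below e.1 x
    · exact ⟨Sum.inr ⟨x, hx⟩, rfl⟩
    · exact ⟨Sum.inl ⟨x, hx⟩, rfl⟩
  · rintro (x | x)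
    · rfl
    · by_cases hx : x = (t.P e).root
      · subst hx
        simp
      · have hx' : x.1 ≠ e.1 := fun h => hx (Subtype.ext h)
        simp only [graft, Sum.elim_inr, if_neg hx]
        exact P_parent_of_ne _ _ _ hx'

/-! Double cuts. -/

/-- An edge of `t` not below `e`, as an edge of `R_e(t)`. -/
abbrev edgeInR (t : RTree) (e f : t.E) (h : ¬ t.Below e.1 f.1) : (t.R e).E :=
  ⟨⟨f.1, h⟩, fun h' => f.2 (congrArg Subtype.val h')⟩

/-- An edge of `t` strictly below `e`, as an edge of `P_e(t)`. -/
abbrev edgeInP (t : RTree) (e f : t.E) (h : t.Below e.1 f.1) (hne : e ≠ f) : (t.P e).E :=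
  ⟨⟨f.1, h⟩, fun h' => hne (Subtype.ext (congrArg Subtype.val h').symm)⟩

theorem not_below_of_ne (t : RTree) {e f : t.E} (h : t.Below e.1 f.1) (hne : e ≠ f) :
    ¬ t.Below f.1 e.1 :=
  fun h' => hne (Subtype.ext (t.below_antisymm h h'))

theorem R_R_of_below (t : RTree) (e f : t.E) (h : t.Below f.1 e.1) (h' : ¬ t.Below e.1 f.1) :
    (t.R e).R (t.edgeInR e f h') ≈ t.R f := by
  refine iso_of_embed (X := t.V) (fun x => x.1.1) Subtype.val
    (Subtype.val_injective.comp Subtype.val_injective) Subtype.val_injective ?_ ?_ rfl ?_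
  · rintro ⟨x, hx⟩
    exact ⟨⟨x.1, fun k => hx ((below_R _ _ _ _).2 k)⟩, rfl⟩
  · rintro ⟨y, hy⟩
    exact ⟨⟨⟨y, fun k => hy (t.below_trans h k)⟩, fun k => hy ((below_R _ _ _ _).1 k)⟩, rfl⟩
  · rintro ⟨⟨x, hx⟩, hx'⟩ ⟨y, hy⟩ rfl
    rfl

theorem P_R_of_below (t : RTree) (e f : t.E) (h : t.Below f.1 e.1) (hne : f ≠ e)
    (h' : ¬ t.Below e.1 f.1) :
    (t.R e).P (t.edgeInR e f h') ≈ (t.P f).R (t.edgeInP f e h hne) := by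
  refine iso_of_embed (X := t.V) (fun x => x.1.1) (fun x => x.1.1)
    (Subtype.val_injective.comp Subtype.val_injective)
    (Subtype.val_injective.comp Subtype.val_injective) ?_ ?_ rfl ?_
  · rintro ⟨x, hx⟩
    exact ⟨⟨⟨x.1, (below_R _ _ _ _).1 hx⟩, fun k => x.2 ((below_P _ _ _ _).1 k)⟩, rfl⟩
  · rintro ⟨y, hy⟩
    exact ⟨⟨⟨y.1, fun k => hy ((below_P _ _ _ _).2 k)⟩, (below_R _ _ _ _).2 y.2⟩, rfl⟩
  · rintro ⟨⟨x, hx⟩, hx'⟩ ⟨⟨y, hy⟩, hy'⟩ h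
    simp only at h
    subst h
    by_cases hxf : x = f.1 <;> simp [P, R, edgeInR, hxf]

theorem P_P (t : RTree) (e f : t.E) (h : t.Below f.1 e.1) (hne : f ≠ e) :
    (t.P f).P (t.edgeInP f e h hne) ≈ t.P e := by
  refine iso_of_embed (X := t.V) (fun x => x.1.1) Subtype.val
    (Subtype.val_injective.comp Subtype.val_injective) Subtype.val_injective ?_ ?_ rfl ?_
  · rintro ⟨x, hx⟩
    exact ⟨⟨x.1, (below_P _ _ _ _).1 hx⟩, rfl⟩
  · rintro ⟨y, hy⟩
    exact ⟨⟨⟨y, t.below_trans h hy⟩, (below_P _ _ _ _).2 hy⟩, rfl⟩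
  · rintro ⟨⟨x, hx⟩, hx'⟩ ⟨y, hy⟩ h'
    simp only at h'
    subst h'
    by_cases hxe : x = e.1
    · simp [P, edgeInP, hxe]
    · have hxf : x ≠ f.1 := by
        rintro rfl
        exact not_below_of_ne t h hne hy
      simp [P, edgeInP, hxe, hxf]

theorem P_R_of_not (t : RTree) (e f : t.E) (h : ¬ t.Below f.1 e.1) (h' : ¬ t.Below e.1 f.1) :
    (t.R e).P (t.edgeInR e f h') ≈ t.P f := by
  refine iso_of_embed (X := t.V) (fun x => x.1.1) Subtype.val
    (Subtype.val_injective.comp Subtype.val_injective) Subtype.val_injective ?_ ?_ rfl ?_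
  · rintro ⟨x, hx⟩
    exact ⟨⟨x.1, (below_R _ _ _ _).1 hx⟩, rfl⟩
  · rintro ⟨y, hy⟩
    exact ⟨⟨⟨y, fun k => (t.below_total hy k).elim h h'⟩, (below_R _ _ _ _).2 hy⟩, rfl⟩
  · rintro ⟨⟨x, hx⟩, hx'⟩ ⟨y, hy⟩ h
    simp only at h
    subst h
    by_cases hxf : x = f.1 <;> simp [P, R, edgeInR, hxf]

theorem R_R_comm (t : RTree) (e f : t.E) (h : ¬ t.Below f.1 e.1) (h' : ¬ t.Below e.1 f.1) :
    (t.R e).R (t.edgeInR e f h') ≈ (t.R f).R (t.edgeInR f e h) := by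
  refine iso_of_embed (X := t.V) (fun x => x.1.1) (fun x => x.1.1)
    (Subtype.val_injective.comp Subtype.val_injective)
    (Subtype.val_injective.comp Subtype.val_injective) ?_ ?_ rfl ?_
  · rintro ⟨x, hx⟩
    exact ⟨⟨⟨x.1, fun k => hx ((below_R _ _ _ _).2 k)⟩, fun k => x.2 ((below_R _ _ _ _).1 k)⟩, rfl⟩
  · rintro ⟨x, hx⟩
    exact ⟨⟨⟨x.1, fun k => hx ((below_R _ _ _ _).2 k)⟩, fun k => x.2 ((below_R _ _ _ _).1 k)⟩, rfl⟩
  · rintro ⟨⟨x, hx⟩, hx'⟩ ⟨⟨y, hy⟩, hy'⟩ h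
    simp only at h
    subst h
    rfl

end RTree

/-- The set of isomorphism classes of finite rooted trees. -/
def Trees : Type 1 := Quotient RTree.setoid

/-- The isomorphism class of a rooted tree. -/
def cls (t : RTree) : Trees := Quotient.mk RTree.setoid t

/-- A representative of an isomorphism class. -/
noncomputable def Trees.rep (t : Trees) : RTree := Quotient.out t

/-- `|t|`, the number of vertices. -/
noncomputable def Trees.size (t : Trees) : ℕ := t.rep.size

/-- `α(t₁, t₂, t₃)`: the number of edges `e` of `t₂` with `R_e(t₂) = t₃` and `P_e(t₂) = t₁`. -/
noncomputable def alpha (t₁ t₂ t₃ : Trees) : ℕ :=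
  Nat.card {e : t₂.rep.E // cls (t₂.rep.R e) = t₃ ∧ cls (t₂.rep.P e) = t₁}

/-- `β(t₁, t₂, t₃)`: the number of vertices `v` of `t₃` with `t₁ = t₃ ∪_v t₂`. -/
noncomputable def beta (t₁ t₂ t₃ : Trees) : ℕ :=
  Nat.card {v : t₃.rep.V // t₁ = cls (t₃.rep.graft v t₂.rep)}

/-- The labels of the standard basis `{d} ∪ {D_t^+} ∪ {D_t^-}`. -/
inductive Idx : Type 1
  | d : Idx
  | plus (t : Trees) : Idx
  | minus (t : Trees) : Idx

/-- The underlying vector space of the insertion-elimination algebra: the complex vector space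
with basis `{d} ∪ {D_t^+} ∪ {D_t^-}`. -/
def IE : Type 1 := Idx →₀ ℂ

noncomputable instance : AddCommGroup IE := inferInstanceAs (AddCommGroup (Idx →₀ ℂ))

noncomputable instance : Module ℂ IE := inferInstanceAs (Module ℂ (Idx →₀ ℂ))

/-- The standard basis. -/
noncomputable def basis : Module.Basis Idx ℂ IE := ⟨LinearEquiv.refl ℂ (Idx →₀ ℂ)⟩

noncomputable def d : IE := basis .d

noncomputable def Dp (t : Trees) : IE := basis (.plus t)

noncomputable def Dm (t : Trees) : IE := basis (.minus t)

open Classical in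
/-- The bracket of two basis vectors:
`[d, D_t^±] = ±|t| D_t^±`,
`[D_s^+, D_t^+] = ∑_r (β(r, s, t) - β(r, t, s)) D_r^+`,
`[D_s^-, D_t^-] = ∑_r (α(t, r, s) - α(s, r, t)) D_r^-`,
`[D_t^-, D_t^+] = d`, and
`[D_s^-, D_t^+] = ∑_r α(s, t, r) D_r^+ + ∑_r β(s, t, r) D_r^-` for `s ≠ t`. All the sums are finite (see `finite_beta` and the
lemmas after it). -/
noncomputable def basisBracket : Idx → Idx → IE
  | .d, .d => 0
  | .d, .plus t => (t.size : ℂ) • Dp t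
  | .d, .minus t => -((t.size : ℂ) • Dm t)
  | .plus t, .d => -((t.size : ℂ) • Dp t)
  | .minus t, .d => (t.size : ℂ) • Dm t
  | .plus s, .plus t => ∑ᶠ r, ((beta r s t : ℂ) - (beta r t s : ℂ)) • Dp r
  | .minus s, .minus t => ∑ᶠ r, ((alpha t r s : ℂ) - (alpha s r t : ℂ)) • Dm r
  | .minus s, .plus t => if s = t then d else
      ∑ᶠ r, (alpha s t r : ℂ) • Dp r + ∑ᶠ r, (beta s t r : ℂ) • Dm r
  | .plus t, .minus s => -(if s = t then d else
      ∑ᶠ r, (alpha s t r : ℂ) • Dp r + ∑ᶠ r, (beta s t r : ℂ) • Dm r)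

/-- The bilinear extension of `basisBracket`. -/
noncomputable def bracketMap : IE →ₗ[ℂ] IE →ₗ[ℂ] IE :=
  basis.constr ℂ fun i => basis.constr ℂ (basisBracket i)

/-! ### The Jacobi identity

It is checked by means of a faithful representation on the vector space spanned by all trees. -/

theorem sum_sum' {A B : Type} [Fintype A] [Fintype B] [h : Fintype (A ⊕ B)] {N : Type*}
    [AddCommMonoid N] (F : A ⊕ B → N) :
    ∑ x, F x = ∑ a, F (Sum.inl a) + ∑ b, F (Sum.inr b) := by
  convert Fintype.sum_sum_type F

theorem sum_subtype' {A : Type} [Fintype A] (p : A → Prop) [h : Fintype {a // p a}]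
    [h' : Fintype {a // ¬ p a}] {N : Type*} [AddCommMonoid N] (F : A → N) :
    ∑ x, F x = ∑ a : {a // p a}, F a.1 + ∑ b : {a // ¬ p a}, F b.1 := by
  classical
  convert (Fintype.sum_subtype_add_sum_subtype p F).symm

section Jacobi

attribute [local instance 10000] Fintype.ofFinite

theorem cls_eq_iff {s t : RTree} : cls s = cls t ↔ s ≈ t := Quotient.eq

theorem cls_rep (t : Trees) : cls t.rep = t := Quotient.out_eq t

theorem rep_cls (t : RTree) : (cls t).rep ≈ t := Quotient.mk_out t

theorem size_cls (t : RTree) : (cls t).size = Nat.card t.V := by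
  obtain ⟨φ, -⟩ := rep_cls t
  exact Nat.card_congr φ

theorem beta_cls (r : Trees) (s t : RTree) :
    beta r (cls s) (cls t) = Nat.card {v : t.V // r = cls (t.graft v s)} := by
  obtain ⟨φ, h0, h1⟩ := rep_cls t
  refine Nat.card_congr (φ.subtypeEquiv fun v => ?_)
  rw [cls_eq_iff.2 (RTree.graft_congr φ h0 h1 (rep_cls s) v)]

theorem alpha_cls (r q : Trees) (t : RTree) :
    alpha q (cls t) r = Nat.card {e : t.E // cls (t.R e) = r ∧ cls (t.P e) = q} := by
  obtain ⟨φ, h0, h1⟩ := rep_cls t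
  have hφ : ∀ x : (cls t).rep.V, x ≠ (cls t).rep.root ↔ φ x ≠ t.root := fun x => by
    rw [← h0, φ.injective.ne_iff]
  refine Nat.card_congr ((φ.subtypeEquiv hφ).subtypeEquiv fun e => ?_)
  rw [cls_eq_iff.2 (RTree.R_map φ h0 h1 e (φ.subtypeEquiv hφ e) rfl),
    cls_eq_iff.2 (RTree.P_map φ h0 h1 e (φ.subtypeEquiv hφ e) rfl)]

section sums

variable {ι : Type} [Finite ι] {N : Type*} [AddCommGroup N] [Module ℂ N]

theorem finsum_card (g : ι → Trees) (X : Trees → N) :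
    ∑ᶠ r, (Nat.card {i // r = g i} : ℂ) • X r = ∑ i, X (g i) := by
  classical
  rw [finsum_eq_sum_of_support_subset (s := Finset.univ.image g),
    Finset.sum_comp X g]
  · refine Finset.sum_congr rfl fun r _ => ?_
    rw [Nat.card_eq_fintype_card, Fintype.card_subtype, Nat.cast_smul_eq_nsmul]
    simp only [eq_comm]
  · intro r hr
    by_contra h
    apply hr
    have : IsEmpty {i // r = g i} := ⟨fun i => h (by simp [i.2])⟩
    simp

open Classical in
theorem finsum_card_and (g : ι → Trees) (p : ι → Prop) (X : Trees → N) :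
    ∑ᶠ r, (Nat.card {i // g i = r ∧ p i} : ℂ) • X r = ∑ i, if p i then X (g i) else 0 := by
  have h := finsum_card (fun i : {i // p i} => g i.1) X
  have h2 : ∀ r, Nat.card {i // g i = r ∧ p i} = Nat.card {i : {i // p i} // r = g i.1} := by
    intro r
    refine Nat.card_congr ⟨fun i => ⟨⟨i.1, i.2.2⟩, i.2.1.symm⟩, fun i => ⟨i.1.1, i.2.symm, i.1.2⟩,
      fun _ => rfl, fun _ => rfl⟩
  simp only [h2, h]
  rw [← Finset.sum_filter]
  exact (Finset.sum_subtype (Finset.univ.filter p) (by simp) (fun i => X (g i))).symm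

theorem finite_card (g : ι → Trees) :
    (Function.support fun r => (Nat.card {i // r = g i} : ℂ)).Finite := by
  classical
  refine (Finset.univ.image g).finite_toSet.subset fun r hr => ?_
  by_contra h
  apply hr
  have : IsEmpty {i // r = g i} := ⟨fun i => h (by simp [i.2])⟩
  simp

end sums

theorem exists_of_beta {r s t : Trees} (h : beta r s t ≠ 0) :
    ∃ v, r = cls (t.rep.graft v s.rep) := by
  by_contra hc
  push Not at hc
  apply h
  have : IsEmpty {v : t.rep.V // r = cls (t.rep.graft v s.rep)} := ⟨fun v => hc v.1 v.2⟩
  simp [beta]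

theorem exists_of_alpha {q r t : Trees} (h : alpha q t r ≠ 0) :
    ∃ e, cls (t.rep.R e) = r ∧ cls (t.rep.P e) = q := by
  by_contra hc
  push Not at hc
  apply h
  have : IsEmpty {e : t.rep.E // cls (t.rep.R e) = r ∧ cls (t.rep.P e) = q} :=
    ⟨fun e => hc e.1 e.2.1 e.2.2⟩
  simp [alpha]

theorem exists_graft_of_alpha {q r t : Trees} (h : alpha q t r ≠ 0) :
    ∃ v, t = cls (r.rep.graft v q.rep) := by
  obtain ⟨e, h1, h2⟩ := exists_of_alpha h
  obtain ⟨v, hv⟩ := t.rep.exists_graft e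
  obtain ⟨φ, h0, hp⟩ : t.rep.R e ≈ r.rep := cls_eq_iff.1 (h1.trans (cls_rep r).symm)
  have h3 : t.rep.P e ≈ q.rep := cls_eq_iff.1 (h2.trans (cls_rep q).symm)
  exact ⟨φ v, by
    rw [← cls_eq_iff.2 (RTree.graft_congr φ h0 hp h3 v), cls_eq_iff.2 hv, cls_rep]⟩

theorem exists_cut_of_beta {r s t : Trees} (h : beta r s t ≠ 0) :
    ∃ e, cls (r.rep.R e) = t ∧ cls (r.rep.P e) = s := by
  obtain ⟨v, hv⟩ := exists_of_beta h
  obtain ⟨φ, h0, hp⟩ : t.rep.graft v s.rep ≈ r.rep := cls_eq_iff.1 (hv.symm.trans (cls_rep r).symm)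
  let e := RTree.edgeR t.rep v s.rep s.rep.root
  have he : φ e.1 ≠ r.rep.root := fun h => e.2 (φ.injective (h.trans h0.symm))
  refine ⟨⟨φ e.1, he⟩, ?_, ?_⟩
  · rw [← cls_eq_iff.2 (RTree.R_map φ h0 hp e ⟨φ e.1, he⟩ rfl),
      cls_eq_iff.2 (RTree.R_join _ _ _), cls_rep]
  · rw [← cls_eq_iff.2 (RTree.P_map φ h0 hp e ⟨φ e.1, he⟩ rfl),
      cls_eq_iff.2 (RTree.P_join _ _ _), cls_rep]

theorem size_of_beta {r s t : Trees} (h : beta r s t ≠ 0) : r.size = t.size + s.size := by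
  obtain ⟨v, rfl⟩ := exists_of_beta h
  rw [size_cls]
  exact Nat.card_sum

theorem size_of_alpha {q r t : Trees} (h : alpha q t r ≠ 0) : t.size = r.size + q.size := by
  obtain ⟨v, rfl⟩ := exists_graft_of_alpha h
  rw [size_cls]
  exact Nat.card_sum

theorem size_pos (t : Trees) : 0 < t.size :=
  have : Nonempty t.rep.V := ⟨t.rep.root⟩
  Nat.card_pos

theorem finite_beta (s t : Trees) : (Function.support fun r => (beta r s t : ℂ)).Finite :=
  finite_card _

theorem finite_alpha (s t : Trees) : (Function.support fun r => (alpha s t r : ℂ)).Finite := by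
  refine (Set.finite_range fun e => cls (t.rep.R e)).subset fun r hr => ?_
  obtain ⟨e, he, -⟩ := exists_of_alpha (Nat.cast_ne_zero.1 hr)
  exact ⟨e, he⟩

theorem finite_alpha' (s t : Trees) : (Function.support fun r => (alpha s r t : ℂ)).Finite := by
  refine (Set.finite_range fun v => cls (t.rep.graft v s.rep)).subset fun r hr => ?_
  obtain ⟨v, hv⟩ := exists_graft_of_alpha (Nat.cast_ne_zero.1 hr)
  exact ⟨v, hv.symm⟩

theorem finite_beta' (s t : Trees) : (Function.support fun r => (beta s t r : ℂ)).Finite := by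
  refine (Set.finite_range fun e => cls (s.rep.R e)).subset fun r hr => ?_
  obtain ⟨e, he, -⟩ := exists_cut_of_beta (Nat.cast_ne_zero.1 hr)
  exact ⟨e, he⟩

/-- The vector space spanned by all trees. -/
abbrev TreeSpace : Type 1 := Trees →₀ ℂ

noncomputable def tr (t : Trees) : TreeSpace := Finsupp.single t 1

noncomputable def grow (s : Trees) : TreeSpace →ₗ[ℂ] TreeSpace :=
  Finsupp.linearCombination ℂ (fun u => ∑ᶠ r, (beta r s u : ℂ) • tr r)

noncomputable def prune (s : Trees) : TreeSpace →ₗ[ℂ] TreeSpace :=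
  Finsupp.linearCombination ℂ (fun u => ∑ᶠ r, (alpha s u r : ℂ) • tr r)

noncomputable def sizeMap : TreeSpace →ₗ[ℂ] TreeSpace :=
  Finsupp.linearCombination ℂ (fun u => (u.size : ℂ) • tr u)

theorem sizeMap_tr (u : Trees) : sizeMap (tr u) = (u.size : ℂ) • tr u := by
  simp [sizeMap, tr]

theorem grow_tr (s u : RTree) : grow (cls s) (tr (cls u)) = ∑ v, tr (cls (u.graft v s)) := by
  have h := finsum_card (fun v => cls (u.graft v s)) tr
  simp only [← beta_cls] at h
  rw [← h]
  simp [grow, tr]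

open Classical in
theorem prune_tr (s : Trees) (u : RTree) :
    prune s (tr (cls u)) = ∑ e : u.E, if cls (u.P e) = s then tr (cls (u.R e)) else 0 := by
  have h := finsum_card_and (fun e => cls (u.R e)) (fun e => cls (u.P e) = s) tr
  simp only [← alpha_cls] at h
  rw [← h]
  simp [prune, tr]

theorem ext_tr {f g : TreeSpace →ₗ[ℂ] TreeSpace}
    (h : ∀ u : RTree, f (tr (cls u)) = g (tr (cls u))) : f = g := by
  refine Finsupp.lhom_ext' fun u => LinearMap.ext_ring ?_
  have := h u.rep
  rwa [cls_rep] at this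

theorem sum_smul_grow (s t : RTree) (u : TreeSpace) :
    ∑ᶠ r, (beta r (cls s) (cls t) : ℂ) • grow r u = ∑ w, grow (cls (t.graft w s)) u := by
  simp only [beta_cls]
  exact finsum_card (fun w => cls (t.graft w s)) (fun r => grow r u)

open Classical in
theorem sum_smul_grow_alpha (s : Trees) (t : RTree) (u : TreeSpace) :
    ∑ᶠ r, (alpha s (cls t) r : ℂ) • grow r u =
      ∑ e : t.E, if cls (t.P e) = s then grow (cls (t.R e)) u else 0 := by
  simp only [alpha_cls]
  exact finsum_card_and (fun e => cls (t.R e)) (fun e => cls (t.P e) = s) (fun r => grow r u)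

theorem sum_smul_prune (c : Trees → ℂ) (hc : (Function.support c).Finite) (u : RTree) :
    ∑ᶠ r, c r • prune r (tr (cls u)) = ∑ e : u.E, c (cls (u.P e)) • tr (cls (u.R e)) := by
  classical
  rw [finsum_eq_sum_of_support_subset (s := hc.toFinset)]
  · simp only [prune_tr, Finset.smul_sum]
    rw [Finset.sum_comm]
    refine Finset.sum_congr rfl fun e _ => ?_
    simp only [smul_ite, smul_zero, Finset.sum_ite_eq, Set.Finite.mem_toFinset,
      Function.mem_support]
    split_ifs with h
    · rfl
    · rw [not_not.1 h, zero_smul]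
  · intro r hr
    simp only [Set.Finite.coe_toFinset, Function.mem_support]
    rintro h
    exact hr (by simp [h])

theorem finite_smul {N : Type*} [AddCommGroup N] [Module ℂ N] {c : Trees → ℂ}
    (hc : (Function.support c).Finite) (X : Trees → N) :
    (Function.support fun r => c r • X r).Finite := by
  refine hc.subset fun r hr h => hr ?_
  simp only [h, zero_smul]

theorem grow_grow (s t u : RTree) : grow (cls s) (grow (cls t) (tr (cls u))) =
    ∑ v : u.V, ∑ w : u.V, tr (cls ((u.graft v t).graft (Sum.inl w) s)) +
      ∑ w : t.V, grow (cls (t.graft w s)) (tr (cls u)) := by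
  simp only [grow_tr, map_sum]
  rw [Finset.sum_comm (s := (Finset.univ : Finset t.V)), ← Finset.sum_add_distrib]
  refine Finset.sum_congr rfl fun v _ => ?_
  refine (sum_sum' _).trans (congrArg₂ _ rfl ?_)
  exact Finset.sum_congr rfl fun w _ => congrArg tr (cls_eq_iff.2 (RTree.graft_assoc u v t w s))

theorem comm_grow_grow (s t : Trees) (u : RTree) :
    grow s (grow t (tr (cls u))) - grow t (grow s (tr (cls u))) =
      ∑ᶠ r, ((beta r s t : ℂ) - (beta r t s : ℂ)) • grow r (tr (cls u)) := by
  have h1 := sum_smul_grow s.rep t.rep (tr (cls u))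
  have h2 := sum_smul_grow t.rep s.rep (tr (cls u))
  have h3 := grow_grow s.rep t.rep u
  have h4 := grow_grow t.rep s.rep u
  simp only [cls_rep] at h1 h2 h3 h4
  simp only [sub_smul]
  rw [finsum_sub_distrib, h1, h2, h3, h4, Finset.sum_comm]
  · simp only [fun v w => cls_eq_iff.2 (RTree.graft_comm u v w s.rep t.rep)]
    abel
  · exact finite_smul (finite_beta s t) _
  · exact finite_smul (finite_beta t s) _

theorem sum_edges_graft {N : Type*} [AddCommMonoid N] (u : RTree) (v : u.V) (t : RTree)
    (F : (u.graft v t).E → N) :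
    ∑ e, F e = ∑ e : u.E, F (RTree.edgeL u v t e) +
      (F (RTree.edgeR u v t t.root) + ∑ e : t.E, F (RTree.edgeR u v t e.1)) := by
  classical
  let φ : u.E ⊕ t.V ≃ (u.graft v t).E :=
    { toFun := Sum.elim (RTree.edgeL u v t) (RTree.edgeR u v t)
      invFun := fun e => match e with
        | ⟨Sum.inl x, h⟩ => Sum.inl ⟨x, fun h' => h (congrArg Sum.inl h')⟩
        | ⟨Sum.inr y, _⟩ => Sum.inr y
      left_inv := by rintro (x | y) <;> rfl
      right_inv := by rintro ⟨x | y, h⟩ <;> rfl }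
  rw [← Fintype.sum_equiv φ (fun x => F (φ x)) _ (fun _ => rfl)]
  refine (sum_sum' _).trans (congrArg₂ _ rfl ?_)
  refine (sum_subtype' (fun y => y = t.root) _).trans (congrArg₂ _ ?_ rfl)
  exact Fintype.sum_subsingleton (fun y : {y : t.V // y = t.root} => _) ⟨t.root, rfl⟩

theorem sum_split {N : Type*} [AddCommMonoid N] (u : RTree) (e : u.E) (F : u.V → N) :
    ∑ v, F v = ∑ v : (u.P e).V, F v.1 + ∑ v : (u.R e).V, F v.1 := by
  exact sum_subtype' (fun v => u.Below e.1 v) F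

open Classical in
theorem comm_prune_grow (s : Trees) (t u : RTree) :
    prune s (grow (cls t) (tr (cls u))) - grow (cls t) (prune s (tr (cls u))) =
      (if s = cls t then sizeMap (tr (cls u)) else 0) +
      ∑ᶠ r, (alpha s (cls t) r : ℂ) • grow r (tr (cls u)) +
      ∑ᶠ r, (beta s (cls t) r : ℂ) • prune r (tr (cls u)) := by
  rw [sum_smul_grow_alpha, sum_smul_prune _ (finite_beta' _ _), sub_eq_iff_eq_add]
  have hu : (if s = cls t then sizeMap (tr (cls u)) else 0) =
      ∑ _v : u.V, if cls t = s then tr (cls u) else 0 := by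
    rw [Finset.sum_const, sizeMap_tr, size_cls, Finset.card_univ, Nat.card_eq_fintype_card]
    by_cases h : s = cls t
    · rw [if_pos h, if_pos h.symm, Nat.cast_smul_eq_nsmul]
    · rw [if_neg h, if_neg (fun h' => h h'.symm), smul_zero]
  have h1 : ∀ e : u.E, (beta s (cls t) (cls (u.P e)) : ℂ) • tr (cls (u.R e)) =
      ∑ v : (u.P e).V, if cls ((u.P e).graft v t) = s then tr (cls (u.R e)) else 0 := by
    intro e
    rw [beta_cls, ← Finset.sum_filter, Finset.sum_const, Nat.card_eq_fintype_card,
      Fintype.card_subtype, Nat.cast_smul_eq_nsmul]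
    simp only [eq_comm]
  have h2 : grow (cls t) (prune s (tr (cls u))) =
      ∑ e : u.E, ∑ v : (u.R e).V, if cls (u.P e) = s then tr (cls ((u.R e).graft v t)) else 0 := by
    rw [prune_tr, map_sum]
    refine Finset.sum_congr rfl fun e _ => ?_
    split_ifs
    · rw [grow_tr]
    · simp
  have h3 : ∑ e : t.E, (if cls (t.P e) = s then grow (cls (t.R e)) (tr (cls u)) else 0) =
      ∑ v : u.V, ∑ e : t.E, if cls (t.P e) = s then tr (cls (u.graft v (t.R e))) else 0 := by
    rw [Finset.sum_comm]
    refine Finset.sum_congr rfl fun e _ => ?_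
    split_ifs
    · rw [grow_tr]
    · simp
  rw [hu, h2, h3, Finset.sum_congr rfl (fun e _ => h1 e), grow_tr, map_sum]
  simp only [prune_tr, sum_edges_graft, Finset.sum_add_distrib]
  simp only [fun v e => cls_eq_iff.2 (RTree.R_edgeR u v t e),
    fun v e => cls_eq_iff.2 (RTree.P_edgeR u v t e),
    fun v => cls_eq_iff.2 (RTree.R_join u v t), fun v => cls_eq_iff.2 (RTree.P_join u v t)]
  rw [Finset.sum_comm]
  have h4 : ∀ e : u.E, (∑ v, if cls ((u.graft v t).P (RTree.edgeL u v t e)) = s then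
        tr (cls ((u.graft v t).R (RTree.edgeL u v t e))) else 0) =
      (∑ v : (u.P e).V, if cls ((u.P e).graft v t) = s then tr (cls (u.R e)) else 0) +
      ∑ v : (u.R e).V, if cls (u.P e) = s then tr (cls ((u.R e).graft v t)) else 0 := by
    intro e
    rw [sum_split u e]
    congr 1
    · refine Finset.sum_congr rfl fun v _ => ?_
      rw [cls_eq_iff.2 (RTree.P_edgeL u v.1 t e v.2), cls_eq_iff.2 (RTree.R_edgeL u v.1 t e v.2)]
    · refine Finset.sum_congr rfl fun v _ => ?_
      rw [cls_eq_iff.2 (RTree.P_edgeL_of_not u v.1 t e v.2),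
        cls_eq_iff.2 (RTree.R_edgeL_of_not u v.1 t e v.2)]
  rw [Finset.sum_congr rfl (fun e _ => h4 e), Finset.sum_add_distrib]
  abel

open Classical in
theorem sum_edges_R {N : Type*} [AddCommMonoid N] (u : RTree) (e : u.E) (F : (u.R e).E → N) :
    ∑ f, F f = ∑ f : u.E, if h : ¬ u.Below e.1 f.1 then F (u.edgeInR e f h) else 0 := by
  rw [Finset.sum_dite, Finset.sum_const_zero, add_zero]
  refine Finset.sum_bij' (fun f _ => ⟨⟨f.1.1, fun h => f.2 (Subtype.ext h)⟩, 
    Finset.mem_filter.2 ⟨Finset.mem_univ _, f.1.2⟩⟩)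
    (fun f _ => u.edgeInR e f.1 (Finset.mem_filter.1 f.2).2) ?_ ?_ ?_ ?_ ?_ <;> simp

open Classical in
theorem sum_edges_P {N : Type*} [AddCommMonoid N] (u : RTree) (e : u.E) (F : (u.P e).E → N) :
    ∑ f, F f = ∑ f : u.E, if h : u.Below e.1 f.1 ∧ e ≠ f then F (u.edgeInP e f h.1 h.2) else 0 := by
  rw [Finset.sum_dite, Finset.sum_const_zero, add_zero]
  refine Finset.sum_bij' (fun f _ => ⟨⟨f.1.1, fun h => by
      have := f.1.2
      rw [h, RTree.below_root_iff] at this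
      exact e.2 this⟩, Finset.mem_filter.2 ⟨Finset.mem_univ _, f.1.2,
      fun h => f.2 (Subtype.ext (congrArg Subtype.val h).symm)⟩⟩)
    (fun f _ => u.edgeInP e f.1 (Finset.mem_filter.1 f.2).2.1 (Finset.mem_filter.1 f.2).2.2)
    ?_ ?_ ?_ ?_ ?_ <;> simp

open Classical in
theorem prune_prune (s t : Trees) (u : RTree) : prune s (prune t (tr (cls u))) =
    ∑ᶠ r, (alpha t r s : ℂ) • prune r (tr (cls u)) +
    ∑ e : u.E, ∑ f : u.E, if h : ¬ u.Below f.1 e.1 ∧ ¬ u.Below e.1 f.1 then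
      if cls (u.P e) = t ∧ cls (u.P f) = s then tr (cls ((u.R e).R (u.edgeInR e f h.2))) else 0
      else 0 := by
  rw [sum_smul_prune _ (finite_alpha' _ _)]
  have h1 : ∀ f : u.E, (alpha t (cls (u.P f)) s : ℂ) • tr (cls (u.R f)) =
      ∑ e : u.E, if h : u.Below f.1 e.1 ∧ f ≠ e then
        if cls ((u.P f).R (u.edgeInP f e h.1 h.2)) = s ∧ cls (u.P e) = t then tr (cls (u.R f))
        else 0 else 0 := by
    intro f
    have h2 := sum_edges_P u f (fun e => if cls ((u.P f).R e) = s ∧ cls ((u.P f).P e) = t then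
      tr (cls (u.R f)) else 0)
    rw [alpha_cls, Nat.card_eq_fintype_card, Fintype.card_subtype, Nat.cast_smul_eq_nsmul,
      ← Finset.sum_const, Finset.sum_filter, h2]
    refine Finset.sum_congr rfl fun e _ => ?_
    by_cases h : u.Below f.1 e.1 ∧ f ≠ e
    · rw [dif_pos h, dif_pos h, cls_eq_iff.2 (RTree.P_P u e f h.1 h.2)]
    · rw [dif_neg h, dif_neg h]
  rw [Finset.sum_congr rfl (fun f _ => h1 f), Finset.sum_comm, ← Finset.sum_add_distrib, prune_tr,
    map_sum]
  refine Finset.sum_congr rfl fun e _ => ?_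
  have h3 : prune s (if cls (u.P e) = t then tr (cls (u.R e)) else 0) =
      ∑ f : (u.R e).E, if cls (u.P e) = t ∧ cls ((u.R e).P f) = s then tr (cls ((u.R e).R f))
        else 0 := by
    by_cases h : cls (u.P e) = t
    · simp [h, prune_tr]
    · simp [h]
  rw [h3, sum_edges_R, ← Finset.sum_add_distrib]
  refine Finset.sum_congr rfl fun f _ => ?_
  by_cases hef : u.Below e.1 f.1
  · have : ¬ (u.Below f.1 e.1 ∧ f ≠ e) := fun h => RTree.not_below_of_ne u h.1 h.2 hef
    simp [hef, this]
  by_cases hfe : u.Below f.1 e.1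
  · have hne : f ≠ e := by
      rintro rfl
      exact hef (u.below_refl _)
    rw [dif_pos hef, dif_pos ⟨hfe, hne⟩, dif_neg (fun h => h.1 hfe), add_zero,
      cls_eq_iff.2 (RTree.R_R_of_below u e f hfe hef),
      cls_eq_iff.2 (RTree.P_R_of_below u e f hfe hne hef)]
    congr 1
    exact propext and_comm
  · rw [dif_pos hef, dif_neg (fun h => hfe h.1), dif_pos ⟨hfe, hef⟩, zero_add,
      cls_eq_iff.2 (RTree.P_R_of_not u e f hfe hef)]

theorem comm_prune_prune (s t : Trees) (u : RTree) :
    prune s (prune t (tr (cls u))) - prune t (prune s (tr (cls u))) =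
      ∑ᶠ r, ((alpha t r s : ℂ) - (alpha s r t : ℂ)) • prune r (tr (cls u)) := by
  classical
  simp only [sub_smul]
  rw [finsum_sub_distrib, prune_prune, prune_prune, add_sub_add_comm, add_eq_left, sub_eq_zero,
    Finset.sum_comm]
  · refine Finset.sum_congr rfl fun f _ => Finset.sum_congr rfl fun e _ => ?_
    by_cases h : ¬ u.Below f.1 e.1 ∧ ¬ u.Below e.1 f.1
    · rw [dif_pos h, dif_pos h.symm, cls_eq_iff.2 (RTree.R_R_comm u e f h.1 h.2)]
      congr 1
      exact propext and_comm
    · rw [dif_neg h, dif_neg (fun h' => h h'.symm)]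
  · exact finite_smul (finite_alpha' t s) _
  · exact finite_smul (finite_alpha' s t) _

theorem size_graft (u : RTree) (v : u.V) (t : RTree) :
    (cls (u.graft v t)).size = (cls u).size + (cls t).size := by
  simp only [size_cls]
  exact Nat.card_sum

theorem size_cut (u : RTree) (e : u.E) :
    (cls u).size = (cls (u.R e)).size + (cls (u.P e)).size := by
  obtain ⟨v, hv⟩ := u.exists_graft e
  rw [← cls_eq_iff.2 hv, size_graft]

theorem comm_size_grow (t : Trees) (u : RTree) :
    sizeMap (grow t (tr (cls u))) - grow t (sizeMap (tr (cls u))) =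
      (t.size : ℂ) • grow t (tr (cls u)) := by
  have h := grow_tr t.rep u
  have h2 := size_graft u
  rw [cls_rep] at h
  rw [sizeMap_tr, map_smul, h, map_sum, Finset.smul_sum, Finset.smul_sum,
    ← Finset.sum_sub_distrib]
  refine Finset.sum_congr rfl fun v _ => ?_
  rw [sizeMap_tr, h2, cls_rep, ← sub_smul]
  push_cast
  ring_nf

theorem comm_size_prune (t : Trees) (u : RTree) :
    sizeMap (prune t (tr (cls u))) - prune t (sizeMap (tr (cls u))) =
      -((t.size : ℂ) • prune t (tr (cls u))) := by
  classical
  rw [sizeMap_tr, map_smul, prune_tr, map_sum, Finset.smul_sum, Finset.smul_sum,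
    ← Finset.sum_sub_distrib, ← Finset.sum_neg_distrib]
  refine Finset.sum_congr rfl fun e _ => ?_
  split_ifs with h
  · rw [sizeMap_tr, size_cut u e, h, ← sub_smul, ← neg_smul]
    push_cast
    ring_nf
  · simp

/-- The action of the basis vectors on the space of trees. -/
noncomputable def act : Idx → Module.End ℂ TreeSpace
  | .d => sizeMap
  | .plus t => grow t
  | .minus t => prune t

noncomputable def rho : IE →ₗ[ℂ] Module.End ℂ TreeSpace := basis.constr ℂ act

theorem rho_basis (i : Idx) : rho (basis i) = act i := basis.constr_basis ℂ act i

theorem rho_d : rho d = sizeMap := rho_basis _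

theorem rho_Dp (t : Trees) : rho (Dp t) = grow t := rho_basis _

theorem rho_Dm (t : Trees) : rho (Dm t) = prune t := rho_basis _

theorem rho_finsum_Dp (c : Trees → ℂ) (hc : (Function.support c).Finite) (x : TreeSpace) :
    rho (∑ᶠ r, c r • Dp r) x = ∑ᶠ r, c r • grow r x := by
  have h := (LinearMap.applyₗ x ∘ₗ rho : IE →ₗ[ℂ] TreeSpace).toAddMonoidHom.map_finsum
    (finite_smul hc Dp)
  refine h.trans (finsum_congr fun r => ?_)
  simp [rho_Dp]

theorem rho_finsum_Dm (c : Trees → ℂ) (hc : (Function.support c).Finite) (x : TreeSpace) :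
    rho (∑ᶠ r, c r • Dm r) x = ∑ᶠ r, c r • prune r x := by
  have h := (LinearMap.applyₗ x ∘ₗ rho : IE →ₗ[ℂ] TreeSpace).toAddMonoidHom.map_finsum
    (finite_smul hc Dm)
  refine h.trans (finsum_congr fun r => ?_)
  simp [rho_Dm]

theorem finite_sub {f g : Trees → ℂ} (hf : (Function.support f).Finite)
    (hg : (Function.support g).Finite) : (Function.support fun r => f r - g r).Finite :=
  (hf.union hg).subset (Function.support_sub f g)

theorem alpha_self (t r : Trees) : alpha t t r = 0 := by
  by_contra h
  have h1 := size_of_alpha h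
  have h2 := size_pos r
  omega

theorem beta_self (t r : Trees) : beta t t r = 0 := by
  by_contra h
  have h1 := size_of_beta h
  have h2 := size_pos r
  omega

theorem rho_minus_plus (s t : Trees) (u : RTree) :
    rho (basisBracket (.minus s) (.plus t)) (tr (cls u)) =
      prune s (grow t (tr (cls u))) - grow t (prune s (tr (cls u))) := by
  classical
  have h := comm_prune_grow s t.rep u
  rw [cls_rep] at h
  rw [h, basisBracket]
  by_cases hst : s = t
  · subst hst
    simp [alpha_self, beta_self, rho_d]
  · rw [if_neg hst, if_neg hst, map_add, zero_add, LinearMap.add_apply,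
      rho_finsum_Dp _ (finite_alpha _ _), rho_finsum_Dm _ (finite_beta' _ _)]

theorem rho_basisBracket (i j : Idx) (u : RTree) : rho (basisBracket i j) (tr (cls u)) =
    act i (act j (tr (cls u))) - act j (act i (tr (cls u))) := by
  cases i <;> cases j
  · simp [basisBracket, act]
  · simp [basisBracket, act, rho_Dp, comm_size_grow]
  · simp [basisBracket, act, rho_Dm, comm_size_prune]
  · simp only [act]
    rw [← neg_sub, comm_size_grow]
    simp [basisBracket, rho_Dp]
  · rename_i s t
    simp only [act, comm_grow_grow, basisBracket]
    exact rho_finsum_Dp _ (finite_sub (finite_beta s t) (finite_beta t s)) _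
  · rename_i t s
    simp only [act]
    rw [← neg_sub, ← rho_minus_plus]
    simp only [basisBracket, map_neg, LinearMap.neg_apply]
  · simp only [act]
    rw [← neg_sub, comm_size_prune]
    simp [basisBracket, rho_Dm]
  · exact rho_minus_plus _ _ _
  · rename_i s t
    simp only [act, comm_prune_prune, basisBracket]
    exact rho_finsum_Dm _ (finite_sub (finite_alpha' t s) (finite_alpha' s t)) _

theorem bracketMap_basis (i j : Idx) : bracketMap (basis i) (basis j) = basisBracket i j := by
  rw [bracketMap, Module.Basis.constr_basis, Module.Basis.constr_basis]

theorem rho_bracket (x y : IE) (w : TreeSpace) :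
    rho (bracketMap x y) w = rho x (rho y w) - rho y (rho x w) := by
  let f : IE →ₗ[ℂ] IE →ₗ[ℂ] TreeSpace →ₗ[ℂ] TreeSpace := bracketMap.compr₂ rho
  let g : IE →ₗ[ℂ] IE →ₗ[ℂ] TreeSpace →ₗ[ℂ] TreeSpace :=
    (LinearMap.mul ℂ (Module.End ℂ TreeSpace)).compl₁₂ rho rho
  have h : ∀ x y w, f x y w + g y x w = g x y w := by
    intro x y w
    have h' : f + g.flip = g := by
      refine basis.ext fun i => basis.ext fun j => ext_tr fun u => ?_
      have h1 : f (basis i) (basis j) (tr (cls u)) = rho (basisBracket i j) (tr (cls u)) := by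
        rw [← bracketMap_basis]
        rfl
      have h2 : ∀ i j, g (basis i) (basis j) (tr (cls u)) = act i (act j (tr (cls u))) := by
        intro i j
        rw [← rho_basis, ← rho_basis]
        rfl
      simp only [LinearMap.add_apply, LinearMap.flip_apply, h1, h2, rho_basisBracket,
        sub_add_cancel]
    exact LinearMap.congr_fun (LinearMap.congr_fun (LinearMap.congr_fun h' x) y) w
  exact eq_sub_of_add_eq (h x y w)

/-- The tree with one vertex. -/
def dot : RTree := ⟨Unit, inferInstance, (), id, rfl, fun _ => ⟨0, rfl⟩⟩

instance : Unique dot.V := inferInstanceAs (Unique Unit)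

instance : IsEmpty dot.E := ⟨fun e => e.2 rfl⟩

theorem size_dot : (cls dot).size = 1 := by
  rw [size_cls]
  exact Nat.card_unique

/-- The tree `dot ∪ t`. -/
noncomputable abbrev stalk (t : Trees) : RTree := dot.graft dot.root t.rep

theorem stalk_injective : Function.Injective fun t => cls (stalk t) := by
  intro s t h
  obtain ⟨φ, h0, hp⟩ := cls_eq_iff.1 h
  let es := RTree.edgeR dot dot.root s.rep s.rep.root
  let et := RTree.edgeR dot dot.root t.rep t.rep.root
  have key : ∀ y : (stalk t).V, (stalk t).parent y = (stalk t).root → y ≠ (stalk t).root →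
      y = et.1 := by
    rintro (⟨⟩ | y) hy hne
    · exact absurd rfl hne
    · by_cases hyr : y = t.rep.root
      · rw [hyr]
      · simp [hyr] at hy
  have hφ : φ es.1 = et.1 := by
    apply key
    · rw [← hp, ← h0]
      simp [es, RTree.edgeR]
    · rw [← h0]
      exact fun h => es.2 (φ.injective h)
  have := cls_eq_iff.2 (RTree.P_map φ h0 hp es et hφ)
  rw [cls_eq_iff.2 (RTree.P_join _ _ _), cls_eq_iff.2 (RTree.P_join _ _ _), cls_rep,
    cls_rep] at this
  exact this

theorem size_stalk (t : Trees) : (cls (stalk t)).size = 1 + t.size := by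
  rw [size_graft, size_dot, cls_rep]

theorem grow_dot (t : Trees) : grow t (tr (cls dot)) = tr (cls (stalk t)) := by
  have h := grow_tr t.rep dot
  rw [cls_rep] at h
  rw [h]
  exact Fintype.sum_subsingleton (fun v : dot.V => tr (cls (dot.graft v t.rep))) dot.root

theorem prune_dot (t : Trees) : prune t (tr (cls dot)) = 0 := by
  classical
  rw [prune_tr]
  exact Fintype.sum_empty _

open Classical in
theorem prune_stalk (s t : Trees) :
    prune s (tr (cls (stalk t))) (cls dot) = if s = t then 1 else 0 := by
  rw [prune_tr, sum_edges_graft, Finset.univ_eq_empty (α := dot.E), Finset.sum_empty, zero_add,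
    cls_eq_iff.2 (RTree.R_join _ _ _), cls_eq_iff.2 (RTree.P_join _ _ _), cls_rep,
    Finsupp.add_apply, Finsupp.finsetSum_apply, Finset.sum_eq_zero, add_zero]
  · by_cases h : s = t
    · simp [h, tr]
    · simp [h, Ne.symm h]
  · intro e _
    rw [cls_eq_iff.2 (RTree.R_edgeR _ _ _ _)]
    have hne : cls (dot.graft dot.root (t.rep.R e)) ≠ cls dot := by
      intro h
      have h1 := congrArg Trees.size h
      rw [size_graft] at h1
      have := size_pos (cls (t.rep.R e))
      omega
    split_ifs
    · simp [tr, hne]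
    · simp

open Classical in
theorem tr_apply (t u : Trees) : tr t u = if t = u then 1 else 0 := Finsupp.single_apply

theorem rho_eq_zero {x : IE} (hx : rho x = 0) : x = 0 := by
  classical
  have hsum : ∀ y : TreeSpace, ∀ w : Trees, ((basis.repr x).sum fun i c => c * (act i y) w) = 0 := by
    intro y w
    have h := congrArg (fun f : Module.End ℂ TreeSpace => f y w) hx
    simpa [rho, Module.Basis.constr_apply, Finsupp.sum, LinearMap.sum_apply,
      Finsupp.finsetSum_apply] using h
  have hext : ∀ (y : TreeSpace) (w : Trees) (i : Idx), (∀ j, basis.repr x j ≠ 0 →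
      (act j y) w = if j = i then 1 else 0) → basis.repr x i = 0 := by
    intro y w i h
    have h1 := hsum y w
    rw [Finsupp.sum, Finset.sum_congr rfl (fun j hj => by
      rw [h j (Finsupp.mem_support_iff.1 hj)])] at h1
    simpa using h1
  have hplus : ∀ t, basis.repr x (.plus t) = 0 := by
    intro t
    refine hext (tr (cls dot)) (cls (stalk t)) _ fun j _ => ?_
    have hne : cls dot ≠ cls (stalk t) := by
      intro h
      have h1 := congrArg Trees.size h
      rw [size_stalk, size_dot] at h1
      have := size_pos t
      omega
    cases j
    · simp [act, sizeMap_tr, tr_apply, hne]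
    · simp [act, grow_dot, tr_apply, stalk_injective.eq_iff]
    · simp [act, prune_dot]
  have hd : basis.repr x .d = 0 := by
    refine hext (tr (cls dot)) (cls dot) _ fun j hj => ?_
    cases j
    · simp [act, sizeMap_tr, tr_apply, size_dot]
    · exact absurd (hplus _) hj
    · simp [act, prune_dot]
  have hminus : ∀ t, basis.repr x (.minus t) = 0 := by
    intro t
    refine hext (tr (cls (stalk t))) (cls dot) _ fun j hj => ?_
    cases j
    · exact absurd hd hj
    · exact absurd (hplus _) hj
    · simp [act, prune_stalk]
  refine basis.ext_elem fun i => ?_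
  rw [map_zero, Finsupp.zero_apply]
  cases i
  · exact hd
  · exact hplus _
  · exact hminus _

theorem rho_injective : Function.Injective rho :=
  (injective_iff_map_eq_zero rho).2 fun _ h => rho_eq_zero h

end Jacobi

/-- The insertion-elimination algebra as a Lie algebra. -/
noncomputable instance : LieRing IE where
  bracket x y := bracketMap x y
  add_lie x y z := LinearMap.map_add₂ bracketMap x y z
  lie_add x y z := map_add (bracketMap x) y z
  lie_self x := by
    apply rho_injective
    refine LinearMap.ext fun w => ?_
    rw [rho_bracket, sub_self, map_zero, LinearMap.zero_apply]
  leibniz_lie x y z := by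
    apply rho_injective
    refine LinearMap.ext fun w => ?_
    simp only [map_add, LinearMap.add_apply, rho_bracket, map_sub]
    abel

noncomputable instance : LieAlgebra ℂ IE where
  lie_smul c x y := map_smul (bracketMap x) c y

theorem basis_lie_basis (i j : Idx) : ⁅basis i, basis j⁆ = basisBracket i j :=
  bracketMap_basis i j

theorem lie_mem_span {S : Set IE} (h : ∀ a ∈ S, ∀ b ∈ S, ⁅a, b⁆ ∈ Submodule.span ℂ S) {x y : IE}
    (hx : x ∈ Submodule.span ℂ S) (hy : y ∈ Submodule.span ℂ S) :
    ⁅x, y⁆ ∈ Submodule.span ℂ S := by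
  induction hx using Submodule.span_induction with
  | mem a ha =>
    induction hy using Submodule.span_induction with
    | mem b hb => exact h a ha b hb
    | zero => simp
    | add b c _ _ hb hc => rw [lie_add]; exact add_mem hb hc
    | smul r b _ hb => rw [lie_smul]; exact Submodule.smul_mem _ _ hb
  | zero => simp
  | add b c _ _ hb hc => rw [add_lie]; exact add_mem hb hc
  | smul r b _ hb => rw [smul_lie]; exact Submodule.smul_mem _ _ hb

/-- The subalgebra `𝔤⁺`, spanned by the `D_t^+`. -/
noncomputable def gPos : LieSubalgebra ℂ IE where
  toSubmodule := Submodule.span ℂ (Set.range Dp)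
  lie_mem' := lie_mem_span <| by
    rintro _ ⟨s, rfl⟩ _ ⟨t, rfl⟩
    rw [Dp, Dp, basis_lie_basis, basisBracket]
    exact finsum_induction (· ∈ Submodule.span ℂ (Set.range Dp)) (zero_mem _)
      (fun _ _ => add_mem) fun r =>
        Submodule.smul_mem _ _ (Submodule.subset_span (Set.mem_range_self r))

/-- The subalgebra `𝔤⁻`, spanned by the `D_t^-`. -/
noncomputable def gNeg : LieSubalgebra ℂ IE where
  toSubmodule := Submodule.span ℂ (Set.range Dm)
  lie_mem' := lie_mem_span <| by
    rintro _ ⟨s, rfl⟩ _ ⟨t, rfl⟩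
    rw [Dm, Dm, basis_lie_basis, basisBracket]
    exact finsum_induction (· ∈ Submodule.span ℂ (Set.range Dm)) (zero_mem _)
      (fun _ _ => add_mem) fun r =>
        Submodule.smul_mem _ _ (Submodule.subset_span (Set.mem_range_self r))

/-- A nonzero element `x` is self-centralizing if it commutes only with its scalar multiples. -/
def IsSelfCentralizing (𝔽 : Type*) {L : Type*} [Field 𝔽] [LieRing L] [LieAlgebra 𝔽 L]
    (x : L) : Prop :=
  x ≠ 0 ∧ ∀ y : L, ⁅x, y⁆ = 0 → ∃ c : 𝔽, y = c • x

/-- A Lie algebra of dimension greater than `1` is completely self-centralizing if every nonzero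
element is self-centralizing. -/
def IsCompletelySelfCentralizing (𝔽 L : Type*) [Field 𝔽] [LieRing L] [LieAlgebra 𝔽 L] : Prop :=
  1 < Module.rank 𝔽 L ∧ ∀ x : L, x ≠ 0 → IsSelfCentralizing 𝔽 x

end InsElim

/-! A rooted tree is determined by the multiset of branches at its root, so a tree `t` can be
encoded as the monomial `M_t` in variables `X_s` (one per tree `s`) that multiplies the variables of
its branches, with multiplicity. The degree of `M_t` is the number of branches, and the one-vertex
tree becomes `1`.

Grafting `s` at the root of `t` multiplies `M_t` by `X_s`, while grafting at any other vertex
changes one branch and keeps their number. Hence, for `s` and `t` with at most `n` branches, the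
bracket of `D_s^+` and `D_t^+` becomes `M_t * X_s - M_s * X_t` modulo polynomials of degree at most
`n` (`finsum_beta_sub_mem`). The same holds for `D_s^-` and `D_t^-` up to sign, once each `M_t` is
divided by the factorials of its branch multiplicities (`finsum_alpha_sub_mem`); these factorials
absorb the multiplicities counted by `alpha`.

Suppose now that `x ≠ 0` commutes with `y`. Let `t` be a largest tree in the support of `x`, and let
`z` be `y` minus the multiple of `x` that kills the coordinate at `t`; then `x` and `z` commute.
Suppose `z ≠ 0`, let `k` be the largest number of branches occurring in `x` or `z`, let `p` and `q`
be the degree `k` parts of their polynomials, and let `l_x`, `l_z` be the linear forms obtained from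
`D_s ↦ X_s`. The degree `k + 1` part of the bracket gives `q * l_x = p * l_z`. The variable `X_t`
occurs in `l_x`, but neither in `l_z` nor in `p`, because a tree with branch `t` is larger than `t`.
Comparing degrees in `X_t` forces `q = 0`, then `p = 0`, against the choice of `k`. So `z = 0` and
`y` is a multiple of `x`. This is `exists_smul_of_lie_eq_zero`, applied to both subalgebras through
`isCompletelySelfCentralizing_of_basis`. -/

namespace InsElim

/-! ### Branches at the root, and how grafting and cutting change them. -/

section Branches

attribute [local instance 10000] Fintype.ofFinite

open Classical in
/-- The multiset of the branches at the root, given by multiplicities. -/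
noncomputable def RTree.branches (t : RTree) : Trees →₀ ℕ :=
  ∑ e : t.E, if t.parent e.1 = t.root then Finsupp.single (cls (t.P e)) 1 else 0

theorem RTree.branches_congr {s t : RTree} (h : s ≈ t) : s.branches = t.branches := by
  classical
  obtain ⟨φ, h0, hp⟩ := h
  have hφ : ∀ x : s.V, x ≠ s.root ↔ φ x ≠ t.root := fun x => by
    rw [← h0, φ.injective.ne_iff]
  let ψ : s.E ≃ t.E := φ.subtypeEquiv hφ
  refine Fintype.sum_equiv ψ _ _ fun e => ?_
  have h1 : t.parent (ψ e).1 = t.root ↔ s.parent e.1 = s.root := by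
    change t.parent (φ e.1) = t.root ↔ _
    rw [← hp, ← h0, φ.injective.eq_iff]
  simp only [h1, cls_eq_iff.2 (RTree.P_map φ h0 hp e (ψ e) rfl)]

/-- No branch of `u` contains the root, so the old branches are untouched; the joining edge adds the
branch `t`, and the edges inside `t` do not meet the root. -/
theorem RTree.branches_graft_root (u t : RTree) :
    (u.graft u.root t).branches = u.branches + Finsupp.single (cls t) 1 := by
  classical
  rw [branches, sum_edges_graft, branches]
  refine congrArg₂ _ (Finset.sum_congr rfl fun e _ => ?_) ?_
  · rw [cls_eq_iff.2 (P_edgeL_of_not u u.root t e fun h => e.2 ((below_root_iff _ _).1 h))]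
    simp only [graft, Sum.elim_inl, Sum.inl.injEq]
  · rw [Finset.sum_eq_zero, add_zero, cls_eq_iff.2 (P_join _ _ _)]
    · simp
    · intro e _
      simp [e.2]

-- Puts multiplicities in the form of a count of edges, so that they can be compared with `alpha`.
open Classical in
theorem RTree.branches_apply (t : RTree) (s : Trees) : t.branches s =
    Nat.card {e : t.E // t.parent e.1 = t.root ∧ cls (t.P e) = s} := by
  rw [branches, Finsupp.finsetSum_apply, Nat.card_eq_fintype_card, Fintype.card_subtype,
    Finset.card_filter]
  refine Finset.sum_congr rfl fun e _ => ?_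
  by_cases h : t.parent e.1 = t.root <;> simp [h, Finsupp.single_apply]

/-- The edges at the root are the same before and after; a branch may grow, but the degree only
counts branches. -/
theorem RTree.degree_branches_graft (u : RTree) {v : u.V} (hv : v ≠ u.root) (t : RTree) :
    (u.graft v t).branches.degree = u.branches.degree := by
  classical
  simp only [branches, map_sum]
  rw [sum_edges_graft, Finset.sum_eq_zero (s := (Finset.univ : Finset t.E)), add_zero]
  · simp only [graft, edgeL, edgeR, Sum.elim_inl, Sum.elim_inr, Sum.inl.injEq, if_true, hv,
      if_false, map_zero, add_zero]
    refine Finset.sum_congr rfl fun e _ => ?_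
    split_ifs <;> simp
  · intro e _
    simp [e.2]

/-- A tree is obtained by grafting the two parts of a cut at the lower endpoint of the edge. -/
theorem RTree.exists_graft_parent (t : RTree) (e : t.E) :
    ∃ v : (t.R e).V, v.1 = t.parent e.1 ∧ (t.R e).graft v (t.P e) ≈ t := by
  have hp : ¬ t.Below e.1 (t.parent e.1) := fun h =>
    t.parent_ne e.2 (t.below_antisymm ⟨1, rfl⟩ h)
  refine ⟨⟨t.parent e.1, hp⟩, rfl, ?_⟩
  refine iso_of_map (Sum.elim Subtype.val Subtype.val) ⟨?_, ?_⟩ rfl ?_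
  · rintro (⟨x, hx⟩ | ⟨x, hx⟩) (⟨y, hy⟩ | ⟨y, hy⟩) h
    · exact congrArg Sum.inl (Subtype.ext h)
    · simp only [Sum.elim_inl, Sum.elim_inr] at h
      exact absurd (h ▸ hy) hx
    · simp only [Sum.elim_inl, Sum.elim_inr] at h
      exact absurd (h ▸ hx) hy
    · exact congrArg Sum.inr (Subtype.ext h)
  · intro x
    by_cases hx : t.Below e.1 x
    · exact ⟨Sum.inr ⟨x, hx⟩, rfl⟩
    · exact ⟨Sum.inl ⟨x, hx⟩, rfl⟩
  · rintro (x | x)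
    · rfl
    · by_cases hx : x = (t.P e).root
      · subst hx
        simp
      · have hx' : x.1 ≠ e.1 := fun h => hx (Subtype.ext h)
        simp only [Sum.elim_inr, if_neg hx]
        exact P_parent_of_ne _ _ _ hx'

theorem RTree.graft_root_of_parent_eq (t : RTree) (e : t.E) (he : t.parent e.1 = t.root) :
    (t.R e).graft (t.R e).root (t.P e) ≈ t := by
  obtain ⟨v, hv, h⟩ := t.exists_graft_parent e
  obtain rfl : v = (t.R e).root := Subtype.ext (hv.trans he)
  exact h

theorem RTree.degree_branches_R (t : RTree) (e : t.E) (he : t.parent e.1 ≠ t.root) :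
    (t.R e).branches.degree = t.branches.degree := by
  obtain ⟨v, hv, h⟩ := t.exists_graft_parent e
  rw [← branches_congr h, degree_branches_graft]
  rintro rfl
  exact he hv.symm

theorem RTree.branches_R (t : RTree) (e : t.E) (he : t.parent e.1 = t.root) :
    t.branches = (t.R e).branches + Finsupp.single (cls (t.P e)) 1 := by
  rw [← branches_graft_root, branches_congr (t.graft_root_of_parent_eq e he)]

theorem RTree.exists_of_branches_ne_zero {t : RTree} {s : Trees} (h : t.branches s ≠ 0) :
    ∃ e : t.E, t.parent e.1 = t.root ∧ cls (t.P e) = s := by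
  rw [branches_apply] at h
  obtain ⟨e⟩ := (Nat.card_ne_zero.1 h).1
  exact ⟨e.1, e.2⟩

/-- The last edge on the path from `x` to the root works. -/
theorem RTree.exists_parent_eq_root {t : RTree} (x : t.V) (hx : x ≠ t.root) :
    ∃ e : t.E, t.parent e.1 = t.root := by
  induction x using t.ind with
  | h0 => exact absurd rfl hx
  | h1 x _ ih =>
    by_cases h : t.parent x = t.root
    · exact ⟨⟨x, hx⟩, h⟩
    · exact ih h

theorem RTree.eq_root_of_branches_eq_zero {t : RTree} (h : t.branches = 0) (x : t.V) :
    x = t.root := by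
  by_contra hx
  obtain ⟨e, he⟩ := exists_parent_eq_root x hx
  have h1 := DFunLike.congr_fun (t.branches_R e he) (cls (t.P e))
  simp [h] at h1

/-- Cut a common branch off both trees, apply induction on the size to what remains, and graft the
branch back at the root. This is what makes distinct trees have distinct monomials. -/
theorem RTree.iso_of_branches_eq (s t : RTree) (h : s.branches = t.branches) : s ≈ t := by
  induction hn : (cls s).size using Nat.strong_induction_on generalizing s t with
  | _ n ih =>
    by_cases h0 : s.branches = 0
    · have hs := eq_root_of_branches_eq_zero h0
      have ht := eq_root_of_branches_eq_zero (h ▸ h0)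
      exact iso_of_map (fun _ => t.root)
        ⟨fun a b _ => (hs a).trans (hs b).symm, fun y => ⟨s.root, (ht y).symm⟩⟩ rfl
        fun _ => t.parent_root.symm
    · obtain ⟨r, hr⟩ := DFunLike.ne_iff.1 h0
      obtain ⟨e, he, her⟩ := exists_of_branches_ne_zero hr
      obtain ⟨f, hf, hfr⟩ := exists_of_branches_ne_zero (h ▸ hr)
      have h1 : (s.R e).branches = (t.R f).branches := by
        rw [s.branches_R e he, t.branches_R f hf, her, hfr] at h
        exact add_right_cancel h
      have h2 := size_cut s e
      have h3 := size_pos (cls (s.P e))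
      obtain ⟨φ, k0, k1⟩ := ih _ (by omega) _ _ h1 rfl
      have h4 := graft_congr φ k0 k1 (cls_eq_iff.1 (her.trans hfr.symm)) (s.R e).root
      rw [k0] at h4
      exact ((s.graft_root_of_parent_eq e he).symm.trans h4).trans
        (t.graft_root_of_parent_eq f hf)

/-! ### Branches of isomorphism classes, and the value of `alpha` for root branches. -/

/-- The multiset of the branches at the root of an isomorphism class of trees. -/
noncomputable def Trees.branches (t : Trees) : Trees →₀ ℕ := t.rep.branches

theorem branches_cls (t : RTree) : (cls t).branches = t.branches :=
  RTree.branches_congr (rep_cls t)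

theorem branches_injective : Function.Injective Trees.branches := by
  intro s t h
  rw [← cls_rep s, ← cls_rep t]
  exact cls_eq_iff.2 (RTree.iso_of_branches_eq _ _ h)

/-- Keeps the variable of a largest tree in a support out of the monomials of that support. -/
theorem size_lt_of_branches_ne_zero (r t : Trees) (h : r.branches t ≠ 0) : t.size < r.size := by
  obtain ⟨e, -, rfl⟩ := RTree.exists_of_branches_ne_zero h
  have h1 := size_cut r.rep e
  have h2 := size_pos (cls (r.rep.R e))
  rw [cls_rep] at h1
  omega

/-- The tree `t ∪ s`, grafted at the root of `t`. -/
noncomputable def Trees.attach (t s : Trees) : Trees := cls (t.rep.graft t.rep.root s.rep)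

theorem branches_attach (t s : Trees) :
    (t.attach s).branches = t.branches + Finsupp.single s 1 := by
  rw [Trees.attach, branches_cls, RTree.branches_graft_root, cls_rep]
  rfl

/-- An edge cutting off `s` leaves `t` exactly when it meets the root. Cutting elsewhere preserves
the number of branches, which is one too many for `t`; cutting a root branch `s` leaves the branches
of `t`, and these determine `t`. So `alpha` counts the branches of `t.attach s` equal to `s`. -/
theorem alpha_attach (s t : Trees) : alpha s (t.attach s) t = t.branches s + 1 := by
  have h : (t.attach s).branches s = t.branches s + 1 := by simp [branches_attach]
  rw [← h, Trees.branches, RTree.branches_apply, alpha]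
  refine Nat.card_congr (Equiv.subtypeEquivRight fun e => and_congr_left fun hP => ?_)
  constructor
  · intro hR
    by_contra hc
    have h1 := RTree.degree_branches_R _ e hc
    rw [← branches_cls, hR] at h1
    change t.branches.degree = (t.attach s).branches.degree at h1
    simp [branches_attach] at h1
  · intro he
    have h1 := RTree.branches_R _ e he
    rw [hP, ← branches_cls ((t.attach s).rep.R e)] at h1
    change (t.attach s).branches = _ at h1
    rw [branches_attach] at h1
    exact (branches_injective (add_right_cancel h1)).symm

/-- The two cases are whether or not the edge that is cut meets the root. -/
theorem eq_attach_or_of_alpha {s r t : Trees} (h : alpha s r t ≠ 0) :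
    r = t.attach s ∨ r.branches.degree = t.branches.degree := by
  obtain ⟨e, rfl, rfl⟩ := exists_of_alpha h
  by_cases he : r.rep.parent e.1 = r.rep.root
  · left
    apply branches_injective
    rw [branches_attach, branches_cls]
    exact RTree.branches_R _ e he
  · right
    rw [branches_cls]
    exact (RTree.degree_branches_R _ e he).symm

/-! ### Branch monomials: leading terms of grafting and pruning. -/

open MvPolynomial

/-- The sum runs over the vertices of `t`. The root contributes the product `M_t * X_s` exactly, and
every other vertex a monomial with as many branches as `t`. -/
theorem finsum_beta_sub_mem (s t : Trees) :
    (∑ᶠ r, (beta r s t : ℂ) • (monomial r.branches 1 : MvPolynomial Trees ℂ)) -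
      monomial t.branches 1 * X s ∈ restrictTotalDegree Trees ℂ t.branches.degree := by
  classical
  have h := finsum_card (fun v => cls (t.rep.graft v s.rep))
    fun r => (monomial r.branches 1 : MvPolynomial Trees ℂ)
  have hX : (monomial t.branches 1 * X s : MvPolynomial Trees ℂ) =
      monomial (cls (t.rep.graft t.rep.root s.rep)).branches 1 := by
    have := branches_attach t s
    rw [Trees.attach] at this
    rw [this, X, monomial_mul, one_mul]
  rw [hX]
  unfold beta
  rw [h, ← Finset.add_sum_erase _ _ (Finset.mem_univ t.rep.root), add_sub_cancel_left]
  refine sum_mem fun v hv => ?_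
  rw [mem_restrictTotalDegree]
  refine (totalDegree_monomial_le _ _).trans (le_of_eq ?_)
  rw [branches_cls]
  exact RTree.degree_branches_graft _ (Finset.ne_of_mem_erase hv) _

/-- The product of the factorials of the multiplicities of the branches. -/
noncomputable def branchFactorial (t : Trees) : ℂ := t.branches.prod fun _ n => (n.factorial : ℂ)

theorem branchFactorial_ne_zero (t : Trees) : branchFactorial t ≠ 0 :=
  Finset.prod_ne_zero_iff.2 fun _ _ => Nat.cast_ne_zero.2 (Nat.factorial_ne_zero _)

/-- Only the multiplicity of `s` changes, and it grows by one. The new factor equals `alpha s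
(t.attach s) t`, which is why weighting by inverse factorials normalizes the leading term of
pruning. -/
theorem branchFactorial_attach (t s : Trees) :
    branchFactorial (t.attach s) = (t.branches s + 1) * branchFactorial t := by
  classical
  -- Isolating the factor at `s` leaves a product that the new branch does not affect.
  have h : ∀ m : Trees →₀ ℕ, (m.prod fun _ n => (n.factorial : ℂ)) =
      (m s).factorial * (m.erase s).prod fun _ n => (n.factorial : ℂ) := fun m =>
    (Finsupp.mul_prod_erase' m s _ fun _ => by simp).symm
  rw [branchFactorial, branchFactorial, branches_attach, h, h t.branches]
  simp [Finsupp.erase_add, Nat.factorial_succ, mul_assoc]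

/-- The term `r = t.attach s` has coefficient `t.branches s + 1`, which cancels against the inverse
factorials. Every other `r` in the sum has as many branches as `t`, by `eq_attach_or_of_alpha`. -/
theorem finsum_alpha_sub_mem (s t : Trees) :
    (∑ᶠ r, (alpha s r t : ℂ) •
        (monomial r.branches (branchFactorial r)⁻¹ : MvPolynomial Trees ℂ)) -
      monomial t.branches (branchFactorial t)⁻¹ * X s ∈
        restrictTotalDegree Trees ℂ t.branches.degree := by
  classical
  have hX : (monomial t.branches (branchFactorial t)⁻¹ * X s : MvPolynomial Trees ℂ) =
      (alpha s (t.attach s) t : ℂ) •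
        monomial (t.attach s).branches (branchFactorial (t.attach s))⁻¹ := by
    have h1 : (t.branches s : ℂ) + 1 ≠ 0 := Nat.cast_add_one_ne_zero _
    rw [alpha_attach, branchFactorial_attach, branches_attach, X, monomial_mul, smul_monomial]
    congr 1
    simp only [smul_eq_mul, Nat.cast_add, Nat.cast_one]
    field_simp
  have hmem : t.attach s ∈ (finite_alpha' s t).toFinset := by
    simp only [Set.Finite.mem_toFinset, Function.mem_support, alpha_attach]
    exact Nat.cast_ne_zero.2 (Nat.succ_ne_zero (t.branches s))
  rw [hX, finsum_eq_sum_of_support_subset (s := (finite_alpha' s t).toFinset),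
    ← Finset.add_sum_erase _ _ hmem, add_sub_cancel_left]
  · refine sum_mem fun r hr => Submodule.smul_mem _ _ ?_
    rw [Finset.mem_erase, Set.Finite.mem_toFinset, Function.mem_support, Nat.cast_ne_zero] at hr
    rw [mem_restrictTotalDegree]
    exact (totalDegree_monomial_le _ _).trans
      (le_of_eq ((eq_attach_or_of_alpha hr.2).resolve_left hr.1))
  · intro r hr
    simp only [Set.Finite.coe_toFinset, Function.mem_support]
    intro h
    exact hr (by simp [h])

end Branches

/-! ### A polynomial criterion for commuting elements to be proportional. -/

section Criterion

open MvPolynomial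

/-- Multiplication by a form of degree `n` shifts the grading by `n`. Used with `n = 1` to read off
the top part of a bracket. -/
theorem homogeneousComponent_mul_of_isHomogeneous {σ R : Type*} [CommSemiring R] (k n : ℕ)
    (p : MvPolynomial σ R) {l : MvPolynomial σ R} (hl : l.IsHomogeneous n) :
    homogeneousComponent (k + n) (p * l) = homogeneousComponent k p * l := by
  classical
  induction p using MvPolynomial.induction_on' with
  | monomial m a =>
    have hm : (monomial m a : MvPolynomial σ R).IsHomogeneous m.degree :=
      isHomogeneous_monomial a rfl
    rw [homogeneousComponent_of_mem (hm.mul hl), homogeneousComponent_of_mem hm]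
    simp only [add_left_inj]
    split_ifs <;> simp
  | add p q hp hq => rw [add_mul, map_add, hp, hq, map_add, add_mul]

variable {𝔽 σ L : Type*} [Field 𝔽] [LieRing L] [LieAlgebra 𝔽 L]

/-- The linear map sending the basis vector indexed by `t` to a multiple of the monomial with
exponent `br t`. -/
noncomputable def branchPoly (b : Module.Basis σ 𝔽 L) (br : σ → σ →₀ ℕ) (w : σ → 𝔽) :
    L →ₗ[𝔽] MvPolynomial σ 𝔽 :=
  b.constr 𝔽 fun t => monomial (br t) (w t)

/-- The linear map sending the basis vector indexed by `t` to the variable indexed by `t`. -/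
noncomputable def linearForm (b : Module.Basis σ 𝔽 L) : L →ₗ[𝔽] MvPolynomial σ 𝔽 :=
  b.constr 𝔽 X

variable (b : Module.Basis σ 𝔽 L) {br : σ → σ →₀ ℕ} {w : σ → 𝔽}

/-- By injectivity of `br` no two basis vectors share a monomial, so when `w r ≠ 0` the coordinate
at `r` can be recovered. -/
theorem coeff_branchPoly (hbr : Function.Injective br) (x : L) (r : σ) :
    coeff (br r) (branchPoly b br w x) = b.repr x r * w r := by
  classical
  rw [branchPoly, Module.Basis.constr_apply, Finsupp.sum, coeff_sum]
  simp only [coeff_smul, coeff_monomial, hbr.eq_iff, smul_eq_mul, mul_ite, mul_zero,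
    Finset.sum_ite_eq', Finsupp.mem_support_iff]
  split_ifs with h
  · rfl
  · rw [not_not.1 h, zero_mul]

theorem exists_of_mem_support_branchPoly {x : L} {m : σ →₀ ℕ}
    (hm : m ∈ (branchPoly b br w x).support) : ∃ r ∈ (b.repr x).support, m = br r := by
  classical
  by_contra hc
  push Not at hc
  rw [mem_support_iff, branchPoly, Module.Basis.constr_apply, Finsupp.sum, coeff_sum] at hm
  refine hm (Finset.sum_eq_zero fun r hr => ?_)
  rw [coeff_smul, coeff_monomial, if_neg (hc r hr).symm, smul_zero]

theorem linearForm_isHomogeneous (x : L) : (linearForm b x).IsHomogeneous 1 := by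
  rw [linearForm, Module.Basis.constr_apply, Finsupp.sum]
  refine IsHomogeneous.sum _ _ _ fun r _ => ?_
  rw [smul_eq_C_mul]
  exact (isHomogeneous_X _ _).C_mul _

theorem coeff_linearForm (x : L) (r : σ) :
    coeff (Finsupp.single r 1) (linearForm b x) = b.repr x r := by
  classical
  rw [linearForm, Module.Basis.constr_apply, Finsupp.sum, coeff_sum]
  simp +contextual [coeff_X, Finsupp.single_left_inj]

theorem degreeOf_linearForm_eq_zero {x : L} {t : σ} (h : b.repr x t = 0) :
    degreeOf t (linearForm b x) = 0 := by
  classical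
  rw [linearForm, Module.Basis.constr_apply, Finsupp.sum]
  refine Nat.le_zero.1 ((degreeOf_sum_le _ _ _).trans (Finset.sup_le fun r hr => ?_))
  rw [smul_eq_C_mul]
  refine (degreeOf_C_mul_le _ _ _).trans (le_of_eq (degreeOf_X_of_ne ?_))
  rintro rfl
  exact Finsupp.mem_support_iff.1 hr h

/-- The bracket of two combinations of basis vectors with at most `k` branches, up to terms with
at most `k` branches. -/
theorem branchPoly_lie_sub_mem {ε : 𝔽}
    (hlie : ∀ s t n, (br s).degree ≤ n → (br t).degree ≤ n →
      branchPoly b br w ⁅b s, b t⁆ - ε • (branchPoly b br w (b t) * linearForm b (b s) -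
        branchPoly b br w (b s) * linearForm b (b t)) ∈ restrictTotalDegree σ 𝔽 n)
    {x y : L} {k : ℕ} (hx : ∀ r ∈ (b.repr x).support, (br r).degree ≤ k)
    (hy : ∀ r ∈ (b.repr y).support, (br r).degree ≤ k) :
    branchPoly b br w ⁅x, y⁆ - ε • (branchPoly b br w y * linearForm b x -
      branchPoly b br w x * linearForm b y) ∈ restrictTotalDegree σ 𝔽 k := by
  let S : Set L := b '' {r | (br r).degree ≤ k}
  have hS : ∀ z : L, (∀ r ∈ (b.repr z).support, (br r).degree ≤ k) → z ∈ Submodule.span 𝔽 S :=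
    fun z hz => b.mem_span_image.2 hz
  -- The error term is bilinear in `x` and `y`, so it suffices to treat basis vectors: `y` is
  -- extended linearly here, `x` afterwards.
  have key : ∀ x ∈ S, ∀ y ∈ Submodule.span 𝔽 S, branchPoly b br w ⁅x, y⁆ -
      ε • (branchPoly b br w y * linearForm b x - branchPoly b br w x * linearForm b y) ∈
        restrictTotalDegree σ 𝔽 k := by
    rintro _ ⟨s, hs, rfl⟩ y hy
    induction hy using Submodule.span_induction with
    | mem y hy =>
      obtain ⟨t, ht, rfl⟩ := hy
      exact hlie s t k hs ht
    | zero => simp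
    | add y z _ _ hy hz =>
      convert add_mem hy hz using 1
      simp only [lie_add, map_add, smul_sub, add_mul, mul_add, smul_add]
      abel
    | smul c y _ hy =>
      convert Submodule.smul_mem _ c hy using 1
      simp only [lie_smul, map_smul, smul_sub, smul_mul_assoc, mul_smul_comm, smul_comm c ε]
  have hx' := hS x hx
  have hy' := hS y hy
  clear hx hy
  induction hx' using Submodule.span_induction with
  | mem x hx => exact key x hx y hy'
  | zero => simp
  | add x z _ _ hx hz =>
    convert add_mem hx hz using 1
    simp only [add_lie, map_add, smul_sub, add_mul, mul_add, smul_add]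
    abel
  | smul c x _ hx =>
    convert Submodule.smul_mem _ c hx using 1
    simp only [smul_lie, map_smul, smul_sub, smul_mul_assoc, mul_smul_comm, smul_comm c ε]

/-- If the number of branches of the terms of a bracket can only grow by adding one of the
arguments as a new branch to the other one, then commuting elements are proportional. -/
theorem exists_smul_of_lie_eq_zero {ε : 𝔽} (hε : ε ≠ 0) (hbr : Function.Injective br)
    (size : σ → ℕ) (hsize : ∀ r t, br r t ≠ 0 → size t < size r) (hw : ∀ t, w t ≠ 0)
    (hlie : ∀ s t n, (br s).degree ≤ n → (br t).degree ≤ n →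
      branchPoly b br w ⁅b s, b t⁆ - ε • (branchPoly b br w (b t) * linearForm b (b s) -
        branchPoly b br w (b s) * linearForm b (b t)) ∈ restrictTotalDegree σ 𝔽 n)
    {x : L} (hx : x ≠ 0) (y : L) (hxy : ⁅x, y⁆ = 0) : ∃ c : 𝔽, y = c • x := by
  classical
  have hsx : (b.repr x).support.Nonempty := by simpa using hx
  -- With `t` of maximal size, no element of the support of `x` can have `t` as a branch.
  obtain ⟨t, ht, htmax⟩ := Finset.exists_max_image _ size hsx
  have htx : b.repr x t ≠ 0 := Finsupp.mem_support_iff.1 ht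
  refine ⟨b.repr y t / b.repr x t, ?_⟩
  rw [← sub_eq_zero]
  -- The scalar is chosen to kill the coordinate at `t`; since `x` commutes with itself, `z` still
  -- commutes with `x`.
  set z := y - (b.repr y t / b.repr x t) • x with hz
  have hzt : b.repr z t = 0 := by simp [hz, htx]
  have hxz : ⁅x, z⁆ = 0 := by simp [hz, hxy]
  clear_value z
  by_contra hz0
  -- The maximum is over both supports together, so `p` and `q` below cannot both vanish, though one
  -- of them may.
  obtain ⟨r, hr, hrmax⟩ := Finset.exists_max_image ((b.repr x).support ∪ (b.repr z).support)
    (fun r => (br r).degree) (hsx.mono Finset.subset_union_left)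
  set k := (br r).degree
  set p := homogeneousComponent k (branchPoly b br w x) with hp
  set q := homogeneousComponent k (branchPoly b br w z) with hq
  -- The bracket is zero and the error has degree at most `k`, so the degree `k + 1` part of the
  -- main term vanishes.
  have heq : q * linearForm b x = p * linearForm b z := by
    have h := branchPoly_lie_sub_mem b hlie (fun r hr => hrmax r (Finset.mem_union_left _ hr))
      (fun r hr => hrmax r (Finset.mem_union_right _ hr))
    rw [hxz, map_zero, zero_sub, neg_mem_iff, Submodule.smul_mem_iff _ hε,
      mem_restrictTotalDegree] at h
    have h' := homogeneousComponent_eq_zero (k + 1) _ (Nat.lt_succ_of_le h)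
    rwa [map_sub, homogeneousComponent_mul_of_isHomogeneous _ _ _ (linearForm_isHomogeneous b x),
      homogeneousComponent_mul_of_isHomogeneous _ _ _ (linearForm_isHomogeneous b z),
      sub_eq_zero] at h'
  have hlx : degreeOf t (linearForm b x) ≠ 0 := by
    intro h
    have h1 := monomial_le_degreeOf t (f := linearForm b x) (m := Finsupp.single t 1)
      (by rwa [mem_support_iff, coeff_linearForm])
    simp [h] at h1
  have hlz : linearForm b z ≠ 0 := by
    intro h
    apply hz0
    refine b.ext_elem fun s => ?_
    rw [← coeff_linearForm, h]
    simp
  -- If `X_t` occurred in `p`, some element of the support of `x` would have branch `t` and hence be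
  -- larger than `t`.
  have hpt : degreeOf t p = 0 := by
    refine Nat.le_zero.1 (degreeOf_le_iff.2 fun m hm => ?_)
    rw [hp, support_homogeneousComponent] at hm
    obtain ⟨s, hs, rfl⟩ := exists_of_mem_support_branchPoly b (Finset.mem_filter.1 hm).1
    by_contra hst
    have h1 := hsize s t (by omega)
    have h2 := htmax s hs
    omega
  -- For `q ≠ 0` the left side of `heq` has positive degree in `X_t`, whereas both factors on the
  -- right have degree zero in it.
  have hq0 : q = 0 := by
    by_contra hq0
    have hp0 : p ≠ 0 := by
      intro h
      rw [h, zero_mul] at heq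
      exact mul_ne_zero hq0 (ne_zero_of_degreeOf_ne_zero hlx) heq
    have h := congrArg (degreeOf t) heq
    rw [degreeOf_mul_eq hq0 (ne_zero_of_degreeOf_ne_zero hlx), degreeOf_mul_eq hp0 hlz, hpt,
      degreeOf_linearForm_eq_zero b hzt] at h
    omega
  have hp0 : p = 0 := by
    rw [hq0, zero_mul] at heq
    exact (mul_eq_zero.1 heq.symm).resolve_right hlz
  -- The monomial of `r` has degree `k`, so it is visible in the degree `k` component. With `p = q =
  -- 0`, this contradicts `r` lying in one of the supports.
  have hc : ∀ v : L, homogeneousComponent k (branchPoly b br w v) = 0 → b.repr v r = 0 := by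
    intro v hv
    have h := congrArg (coeff (br r)) hv
    rw [coeff_homogeneousComponent, if_pos rfl, coeff_branchPoly b hbr, coeff_zero] at h
    exact (mul_eq_zero.1 h).resolve_right (hw r)
  rcases Finset.mem_union.1 hr with h | h
  · exact Finsupp.mem_support_iff.1 h (hc x hp0)
  · exact Finsupp.mem_support_iff.1 h (hc z hq0)

end Criterion

open MvPolynomial

/-! ### Lie algebras with a basis indexed by trees. -/

section TreeBracket

variable {L : Type*} [LieRing L] [LieAlgebra ℂ L]

/-- Common form of the two cases: `c s t r` is the coefficient of `r` when `s` is added to `t`,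
namely `beta r s t` or `alpha s r t`, and `hpoly` says that its leading term is multiplication by `X
s`. Antisymmetrizing `hpoly` gives the hypothesis of `exists_smul_of_lie_eq_zero`. -/
theorem isCompletelySelfCentralizing_of_basis (b : Module.Basis Trees ℂ L) {w : Trees → ℂ}
    (hw : ∀ t, w t ≠ 0) {ε : ℂ} (hε : ε ≠ 0) (c : Trees → Trees → Trees → ℂ)
    (hc : ∀ s t, (Function.support (c s t)).Finite)
    (hlie : ∀ s t, ⁅b s, b t⁆ = ε • ∑ᶠ r, (c s t r - c t s r) • b r)
    (hpoly : ∀ s t, (∑ᶠ r, c s t r • (monomial r.branches (w r) : MvPolynomial Trees ℂ)) -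
      monomial t.branches (w t) * X s ∈ restrictTotalDegree Trees ℂ t.branches.degree) :
    IsCompletelySelfCentralizing ℂ L := by
  constructor
  · have h := b.mk_eq_rank
    rw [← Cardinal.one_lt_lift_iff, ← h, Cardinal.one_lt_lift_iff, Cardinal.one_lt_iff_nontrivial]
    -- The trees with one and with two vertices are distinct, so the basis has more than one
    -- element.
    refine ⟨cls dot, cls (stalk (cls dot)), fun h => ?_⟩
    have h1 := congrArg Trees.size h
    rw [size_stalk, size_dot] at h1
    omega
  · refine fun x hx => ⟨hx, exists_smul_of_lie_eq_zero b hε branches_injective Trees.size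
      size_lt_of_branches_ne_zero hw (fun s t n hs ht => ?_) hx⟩
    have hb : ∀ t, branchPoly b Trees.branches w (b t) = monomial t.branches (w t) := fun t =>
      b.constr_basis ..
    have hX : ∀ t, linearForm b (b t) = X t := fun t => b.constr_basis ..
    have hmono : ∀ {m}, m ≤ n → restrictTotalDegree Trees ℂ m ≤ restrictTotalDegree Trees ℂ n :=
      fun hm p hp => (mem_restrictTotalDegree _ _ _).2
        (((mem_restrictTotalDegree _ _ _).1 hp).trans hm)
    have hmap : branchPoly b Trees.branches w (∑ᶠ r, (c s t r - c t s r) • b r) =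
        ∑ᶠ r, c s t r • monomial r.branches (w r) - ∑ᶠ r, c t s r • monomial r.branches (w r) := by
      have h := (branchPoly b Trees.branches w).toAddMonoidHom.map_finsum
        (finite_smul (finite_sub (hc s t) (hc t s)) b)
      refine h.trans ?_
      rw [← finsum_sub_distrib (finite_smul (hc s t) _) (finite_smul (hc t s) _)]
      refine finsum_congr fun r => ?_
      simp [hb, sub_smul]
    rw [hlie, map_smul, hmap, hb, hb, hX, hX, ← smul_sub, sub_sub_sub_comm]
    -- The two errors are bounded by the numbers of branches of `t` and of `s`, both at most `n`.
    exact Submodule.smul_mem _ _ (sub_mem (hmono ht (hpoly s t)) (hmono hs (hpoly t s)))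

end TreeBracket

/-! ### The subalgebras `gPos` and `gNeg`. -/

theorem coe_finsum_smul {R M : Type*} [Ring R] [AddCommGroup M] [Module R M] (N : Submodule R M)
    {ι : Type*} {c : ι → R} (hc : (Function.support c).Finite) (f : ι → N) :
    ((∑ᶠ r, c r • f r : N) : M) = ∑ᶠ r, c r • (f r : M) :=
  N.subtype.toAddMonoidHom.map_finsum
    (hc.subset fun r hr h => hr (by simp only [h, zero_smul]))

theorem linearIndependent_Dp : LinearIndependent ℂ Dp :=
  basis.linearIndependent.comp Idx.plus fun _ _ h => Idx.plus.inj h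

theorem linearIndependent_Dm : LinearIndependent ℂ Dm :=
  basis.linearIndependent.comp Idx.minus fun _ _ h => Idx.minus.inj h

/-- The basis `D_t^+` of `𝔤⁺`. -/
noncomputable def gPosBasis : Module.Basis Trees ℂ gPos :=
  Module.Basis.span linearIndependent_Dp

/-- The basis `D_t^-` of `𝔤⁻`. -/
noncomputable def gNegBasis : Module.Basis Trees ℂ gNeg :=
  Module.Basis.span linearIndependent_Dm

theorem coe_gPosBasis (t : Trees) : (gPosBasis t : IE) = Dp t :=
  congrArg Subtype.val (Module.Basis.span_apply linearIndependent_Dp t)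

theorem coe_gNegBasis (t : Trees) : (gNegBasis t : IE) = Dm t :=
  congrArg Subtype.val (Module.Basis.span_apply linearIndependent_Dm t)

/-- Each vertex of `t` contributes one grafted tree, so unit weights suffice. -/
theorem isCompletelySelfCentralizing_gPos : IsCompletelySelfCentralizing ℂ gPos := by
  refine isCompletelySelfCentralizing_of_basis gPosBasis (fun _ => one_ne_zero) one_ne_zero
    (fun s t r => (beta r s t : ℂ)) finite_beta (fun s t => Subtype.ext ?_) finsum_beta_sub_mem
  rw [one_smul, LieSubalgebra.coe_bracket, coe_gPosBasis, coe_gPosBasis, Dp, Dp, basis_lie_basis,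
    basisBracket]
  refine Eq.trans ?_ (coe_finsum_smul gPos.toSubmodule
    (finite_sub (finite_beta s t) (finite_beta t s)) gPosBasis).symm
  exact finsum_congr fun r => by rw [coe_gPosBasis]

/-- The weights are the inverse branch factorials. The sign is `-1` because `alpha s r t`, which
adds `s` to `t`, enters the bracket of `D_s^-` and `D_t^-` negatively. -/
theorem isCompletelySelfCentralizing_gNeg : IsCompletelySelfCentralizing ℂ gNeg := by
  refine isCompletelySelfCentralizing_of_basis gNegBasis
    (fun t => inv_ne_zero (branchFactorial_ne_zero t)) (neg_ne_zero.2 one_ne_zero)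
    (fun s t r => (alpha s r t : ℂ)) finite_alpha' (fun s t => Subtype.ext ?_)
    finsum_alpha_sub_mem
  rw [neg_one_smul, ← finsum_neg_distrib, LieSubalgebra.coe_bracket, coe_gNegBasis,
    coe_gNegBasis, Dm, Dm, basis_lie_basis, basisBracket]
  simp only [← neg_smul, neg_sub]
  refine Eq.trans ?_ (coe_finsum_smul gNeg.toSubmodule
    (finite_sub (finite_alpha' t s) (finite_alpha' s t)) gNegBasis).symm
  exact finsum_congr fun r => by rw [coe_gNegBasis]

end InsElim

theorem mainTheorem4 :
    InsElim.IsCompletelySelfCentralizing ℂ InsElim.gPos ∧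
      InsElim.IsCompletelySelfCentralizing ℂ InsElim.gNeg :=
  ⟨InsElim.isCompletelySelfCentralizing_gPos, InsElim.isCompletelySelfCentralizing_gNeg⟩
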